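/- A weight function system on $\mathbb{R}^d$ is a family $\mathscr{W}=\{w^\lambda:\lambda\in(0,\infty)\}$ of continuous functions $w^\lambda:\mathbb{R}^d\to[1,\infty)$ with $w^\lambda(x)\le w^\mu(x)$ for all $x$ whenever $\mu\le\lambda$. Consider the conditions - $\{M\}$: $\forall \mu,\nu>0\ \exists \lambda>0\ \exists C>0\ \forall x,y\in\mathbb{R}^d:\ w^\lambda(x+y)\le C w^\mu(x)w^\nu(y)$; - $\{Sq\}$: $\forall \nu>0\ \exists \lambda,\mu>0\ \exists C>0\ \forall x\in\mathbb{R}^d:\ w^\lambda(x)w^\mu(x)\le C w^\nu(x)$; - $\{N\}$: $\forall \mu>0\ \exists \lambda>0:\ w^\lambda/w^\mu\in L^1(\mathbb{R}^d)$. The maximal Nachbin family $\overline{V}(\mathscr{W})$ is the set of all non-negative upper semicontinuous functions $w$ on $\mathbb{R}^d$ with $\sup_{x} w(x)/w^\lambda(x)<\infty$ for all $\lambda>0$. For non-negative functions $v,w$ on $\mathbb{R}^d$, let $\mathcal{S}^v_w$ be the seminormed space of all tempered distributions $\varphi$ on $\mathbb{R}^d$ such that $\varphi$ and its Fourier transform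 $\widehat\varphi$ (normalized by $\widehat\varphi(\xi)=\int\varphi(t)e^{-2\pi i\xi\cdot t}\,dt$ for integrable $\varphi$) are continuous functions and $$\|\varphi\|_{\mathcal{S}^v_w}=\sup_{x}|\varphi(x)|w(x)+\sup_{\xi}|\widehat\varphi(\xi)|v(\xi)<\infty.$$ For weight function systems $\mathscr{V}=\{v^\lambda\}$ and $\mathscr{W}=\{w^\lambda\}$, let $$\mathcal{S}^{\{\mathscr{V}\}}_{\{\mathscr{W}\}}=\varinjlim_{\lambda\to\infty}\mathcal{S}^{v^\lambda}_{w^\lambda},$$ that is, the union of these spaces with the finest locally convex vector space topology for which all inclusions $\mathcal{S}^{v^\lambda}_{w^\lambda}\to\mathcal{S}^{\{\mathscr{V}\}}_{\{\mathscr{W}\}}$ are continuous. Let its projective description $\overline{\mathcal{S}}^{\{\mathscr{V}\}}_{\{\mathscr{W}\}}$ be the space of all $\varphi$ that belong to $\mathcal{S}^v_w$ for every $v\in\overline{V}(\mathscr{V})$ and $w\in\overline{V}(\mathscr{W})$, with the locally convex topology generated by the seminorms $\|\cdot\|_{\mathcal{S}^v_w}$, $v\in\overline{V}(\mathscr{V})$,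 $w\in\overline{V}(\mathscr{W})$. **Theorem.** Let $\mathscr{V}$ and $\mathscr{W}$ be weight function systems on $\mathbb{R}^d$, both satisfying $\{M\}$, $\{Sq\}$ and $\{N\}$. Then $\mathcal{S}^{\{\mathscr{V}\}}_{\{\mathscr{W}\}}$ and $\overline{\mathcal{S}}^{\{\mathscr{V}\}}_{\{\mathscr{W}\}}$ coincide as sets and as topological vector spaces. -/

import Mathlib

open MeasureTheory FourierTransform SchwartzMap
open scoped NNReal

namespace BeurlingBjorck

/-- The Euclidean space `ℝᵈ`. -/
abbrev Rd (d : ℕ) : Type := EuclideanSpace ℝ (Fin d)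

/-! ### Weight function systems -/

/-- A weight function system on `ℝᵈ`: a family `w^λ`, `λ ∈ (0, ∞)`, of continuous functions
`ℝᵈ → [1, ∞)` with `w^λ ≤ w^μ` pointwise whenever `μ ≤ λ`. -/
structure WeightFunctionSystem (d : ℕ) where
  weight : Set.Ioi (0 : ℝ) → Rd d → ℝ≥0
  continuous_weight : ∀ l, Continuous (weight l)
  one_le_weight : ∀ l x, 1 ≤ weight l x
  weight_le_weight : ∀ l m, m ≤ l → ∀ x, weight l x ≤ weight m x

namespace WeightFunctionSystem

variable {d : ℕ}

/-- The condition `{M}`. -/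
def RoumieuM (W : WeightFunctionSystem d) : Prop :=
  ∀ m n : Set.Ioi (0 : ℝ), ∃ l : Set.Ioi (0 : ℝ), ∃ C : ℝ≥0, 0 < C ∧
    ∀ x y : Rd d, W.weight l (x + y) ≤ C * W.weight m x * W.weight n y

/-- The condition `{Sq}`. -/
def RoumieuSq (W : WeightFunctionSystem d) : Prop :=
  ∀ n : Set.Ioi (0 : ℝ), ∃ l m : Set.Ioi (0 : ℝ), ∃ C : ℝ≥0, 0 < C ∧
    ∀ x : Rd d, W.weight l x * W.weight m x ≤ C * W.weight n x

/-- The condition `{N}`. -/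
def RoumieuN (W : WeightFunctionSystem d) : Prop :=
  ∀ m : Set.Ioi (0 : ℝ), ∃ l : Set.Ioi (0 : ℝ),
    Integrable (fun x : Rd d => (W.weight l x : ℝ) / (W.weight m x : ℝ)) volume

/-- The maximal Nachbin family of `W`: the non-negative upper semicontinuous functions `w` on `ℝᵈ`
such that `w / w^λ` is bounded for every `λ > 0`. -/
def nachbin (W : WeightFunctionSystem d) : Set (Rd d → ℝ≥0) :=
  {w | UpperSemicontinuous w ∧
    ∀ l : Set.Ioi (0 : ℝ), BddAbove (Set.range fun x => w x / W.weight l x)}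

theorem zero_mem_nachbin (W : WeightFunctionSystem d) : (0 : Rd d → ℝ≥0) ∈ W.nachbin :=
  ⟨upperSemicontinuous_const, fun _ => ⟨0, by rintro _ ⟨x, rfl⟩; simp⟩⟩

instance (W : WeightFunctionSystem d) : Nonempty W.nachbin := ⟨⟨0, W.zero_mem_nachbin⟩⟩

end WeightFunctionSystem

/-! ### Tempered distributions that are continuous functions -/

section Represents

variable {d : ℕ}

/-- The tempered distribution `T` is the continuous function `f`, i.e. `⟨T, g⟩ = ∫ g f` for all test
functions `g ∈ C_c^∞(ℝᵈ)`. (No growth of `f` is imposed here, whence the compact supports.) -/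
def Represents (f : C(Rd d, ℂ)) (T : 𝓢'(Rd d, ℂ)) : Prop :=
  ∀ g : 𝓢(Rd d, ℂ), HasCompactSupport g → T g = ∫ x, g x * f x

theorem integrable_mul (f : C(Rd d, ℂ)) (g : 𝓢(Rd d, ℂ)) (hg : HasCompactSupport g) :
    Integrable (fun x => g x * f x) volume :=
  (g.continuous.mul f.continuous).integrable_of_hasCompactSupport hg.mul_right

theorem Represents.unique {f g : C(Rd d, ℂ)} {T : 𝓢'(Rd d, ℂ)} (hf : Represents f T)
    (hg : Represents g T) : f = g := by
  have hae : (f : Rd d → ℂ) =ᵐ[volume] g := by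
    refine ae_eq_of_integral_contDiff_smul_eq f.continuous.locallyIntegrable
      g.continuous.locallyIntegrable fun u hu hc => ?_
    have hc' : HasCompactSupport fun x => (u x : ℂ) := hc.comp_left Complex.ofReal_zero
    have hu' : ContDiff ℝ (↑(⊤ : ℕ∞)) fun x => (u x : ℂ) := Complex.ofRealCLM.contDiff.comp hu
    have h1 := hf (hc'.toSchwartzMap hu') hc'
    have h2 := hg (hc'.toSchwartzMap hu') hc'
    simpa using h1.symm.trans h2
  exact ContinuousMap.ext fun x =>
    congrFun (Continuous.ae_eq_iff_eq volume f.continuous g.continuous |>.1 hae) x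

theorem Represents.zero : Represents (0 : C(Rd d, ℂ)) 0 := fun g _ => by simp

theorem Represents.add {f g : C(Rd d, ℂ)} {T U : 𝓢'(Rd d, ℂ)} (hf : Represents f T)
    (hg : Represents g U) : Represents (f + g) (T + U) := fun u hu => by
  have h : (T + U) u = T u + U u := rfl
  rw [h, hf u hu, hg u hu, ← integral_add (integrable_mul f u hu) (integrable_mul g u hu)]
  simp [mul_add]

theorem Represents.smul {f : C(Rd d, ℂ)} {T : 𝓢'(Rd d, ℂ)} (c : ℂ) (hf : Represents f T) :
    Represents (c • f) (c • T) := fun u hu => by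
  have h : (c • T) u = c * T u := rfl
  rw [h, hf u hu, ← integral_const_mul]
  exact integral_congr_ae (Filter.Eventually.of_forall fun x => by simp [mul_left_comm])

open Classical in
/-- The continuous function that the tempered distribution `T` is (zero if there is none). -/
noncomputable def density (T : 𝓢'(Rd d, ℂ)) : C(Rd d, ℂ) :=
  if h : ∃ f, Represents f T then h.choose else 0

theorem Represents.density_eq {f : C(Rd d, ℂ)} {T : 𝓢'(Rd d, ℂ)} (hf : Represents f T) :
    density T = f := by
  have h : ∃ f, Represents f T := ⟨f, hf⟩
  rw [density, dif_pos h]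
  exact h.choose_spec.unique hf

end Represents

/-! ### Weighted spaces of continuous functions -/

section Weighted

variable {d : ℕ}

/-- The space `C_w` of the continuous functions `f` with `‖f‖_w = sup |f| w < ∞`. -/
def weightedSpace (w : Rd d → ℝ≥0) : Submodule ℂ C(Rd d, ℂ) where
  carrier := {f | BddAbove (Set.range fun x => ‖f x‖ * (w x : ℝ))}
  zero_mem' := ⟨0, by rintro _ ⟨x, rfl⟩; simp⟩
  add_mem' := by
    rintro f g ⟨A, hA⟩ ⟨B, hB⟩
    refine ⟨A + B, ?_⟩
    rintro _ ⟨x, rfl⟩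
    have h1 := hA ⟨x, rfl⟩
    have h2 := hB ⟨x, rfl⟩
    have h3 := mul_le_mul_of_nonneg_right (norm_add_le (f x) (g x)) (w x).coe_nonneg
    simp only [ContinuousMap.add_apply] at *
    linarith [add_mul ‖f x‖ ‖g x‖ (w x : ℝ)]
  smul_mem' := by
    rintro c f ⟨A, hA⟩
    refine ⟨‖c‖ * A, ?_⟩
    rintro _ ⟨x, rfl⟩
    have h1 := mul_le_mul_of_nonneg_left (hA ⟨x, rfl⟩) (norm_nonneg c)
    simpa [mul_assoc] using h1

/-- The seminorm `‖f‖_w = sup |f| w`. -/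
noncomputable def supNorm (w : Rd d → ℝ≥0) (f : C(Rd d, ℂ)) : ℝ := ⨆ x, ‖f x‖ * (w x : ℝ)

theorem supNorm_zero (w : Rd d → ℝ≥0) : supNorm w 0 = 0 := by simp [supNorm]

theorem supNorm_add_le {w : Rd d → ℝ≥0} {f g : C(Rd d, ℂ)} (hf : f ∈ weightedSpace w)
    (hg : g ∈ weightedSpace w) : supNorm w (f + g) ≤ supNorm w f + supNorm w g := by
  refine ciSup_le fun x => ?_
  have h1 : ‖f x‖ * (w x : ℝ) ≤ supNorm w f := le_ciSup hf x
  have h2 : ‖g x‖ * (w x : ℝ) ≤ supNorm w g := le_ciSup hg x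
  have h3 := mul_le_mul_of_nonneg_right (norm_add_le (f x) (g x)) (w x).coe_nonneg
  simp only [ContinuousMap.add_apply]
  linarith [add_mul ‖f x‖ ‖g x‖ (w x : ℝ)]

theorem supNorm_smul (w : Rd d → ℝ≥0) (c : ℂ) (f : C(Rd d, ℂ)) :
    supNorm w (c • f) = ‖c‖ * supNorm w f := by
  simp only [supNorm, Real.mul_iSup_of_nonneg (norm_nonneg c), ContinuousMap.smul_apply,
    norm_smul, mul_assoc]

end Weighted

/-! ### The seminormed spaces `S^v_w` -/

section BB

variable {d : ℕ}

/-- `S^v_w` as a subspace of the tempered distributions: those `φ` such that `φ` and its Fourier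
transform are continuous functions with `‖φ‖_w < ∞` and `‖φ̂‖_v < ∞`. -/
noncomputable def bbSubmodule (v w : Rd d → ℝ≥0) : Submodule ℂ 𝓢'(Rd d, ℂ) where
  carrier := {T | (∃ f ∈ weightedSpace w, Represents f T) ∧
    ∃ g ∈ weightedSpace v, Represents g (𝓕 T)}
  zero_mem' := ⟨⟨0, Submodule.zero_mem _, Represents.zero⟩, 0, Submodule.zero_mem _, by
    rw [FourierTransform.fourier_zero]; exact Represents.zero⟩
  add_mem' := by
    rintro T U ⟨⟨f, hf, hfT⟩, g, hg, hgT⟩ ⟨⟨f', hf', hfU⟩, g', hg', hgU⟩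
    refine ⟨⟨f + f', Submodule.add_mem _ hf hf', hfT.add hfU⟩,
      g + g', Submodule.add_mem _ hg hg', ?_⟩
    rw [FourierTransform.fourier_add]
    exact hgT.add hgU
  smul_mem' := by
    rintro c T ⟨⟨f, hf, hfT⟩, g, hg, hgT⟩
    refine ⟨⟨c • f, Submodule.smul_mem _ c hf, hfT.smul c⟩,
      c • g, Submodule.smul_mem _ c hg, ?_⟩
    rw [FourierTransform.fourier_smul]
    exact hgT.smul c

/-- The seminorm `‖φ‖_{S^v_w} = ‖φ‖_w + ‖φ̂‖_v` on `S^v_w`. -/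
noncomputable def bbSeminorm (v w : Rd d → ℝ≥0) : Seminorm ℂ (bbSubmodule v w) :=
  Seminorm.of
    (fun T => supNorm w (density (T : 𝓢'(Rd d, ℂ))) + supNorm v (density (𝓕 (T : 𝓢'(Rd d, ℂ)))))
    (by
      rintro ⟨T, ⟨f, hf, hfT⟩, g, hg, hgT⟩ ⟨U, ⟨f', hf', hfU⟩, g', hg', hgU⟩
      have h1 := hfT.add hfU
      have h2 := hgT.add hgU
      rw [← FourierTransform.fourier_add] at h2
      simp only [Submodule.coe_add, h1.density_eq, h2.density_eq, hfT.density_eq, hfU.density_eq,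
        hgT.density_eq, hgU.density_eq]
      linarith [supNorm_add_le hf hf', supNorm_add_le hg hg'])
    (by
      rintro c ⟨T, ⟨f, hf, hfT⟩, g, hg, hgT⟩
      have h1 := hfT.smul c
      have h2 := hgT.smul c
      rw [← FourierTransform.fourier_smul] at h2
      simp only [Submodule.coe_smul, h1.density_eq, h2.density_eq, hfT.density_eq, hgT.density_eq,
        supNorm_smul, mul_add])

/-- The space `S^v_w`, seminormed by `‖φ‖_{S^v_w}`. (A type of its own, so that it does not carry
the topology of the space of tempered distributions.) -/
def BBSpace (v w : Rd d → ℝ≥0) : Type := bbSubmodule v w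

noncomputable instance (v w : Rd d → ℝ≥0) : AddCommGroup (BBSpace v w) :=
  inferInstanceAs (AddCommGroup (bbSubmodule v w))

noncomputable instance (v w : Rd d → ℝ≥0) : Module ℂ (BBSpace v w) :=
  inferInstanceAs (Module ℂ (bbSubmodule v w))

noncomputable instance (v w : Rd d → ℝ≥0) : SeminormedAddCommGroup (BBSpace v w) :=
  (bbSeminorm v w).toAddGroupSeminorm.toSeminormedAddCommGroup

end BB

/-! ### The Roumieu space `S^{V}_{W}` -/

section Roumieu

variable {d : ℕ}

theorem bbSubmodule_le {v v' w w' : Rd d → ℝ≥0} (hv : ∀ x, v' x ≤ v x) (hw : ∀ x, w' x ≤ w x) :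
    bbSubmodule v w ≤ bbSubmodule v' w' := by
  have key : ∀ {u u' : Rd d → ℝ≥0}, (∀ x, u' x ≤ u x) → weightedSpace u ≤ weightedSpace u' := by
    rintro u u' h f ⟨A, hA⟩
    refine ⟨A, ?_⟩
    rintro _ ⟨x, rfl⟩
    exact (mul_le_mul_of_nonneg_left (NNReal.coe_le_coe.2 (h x)) (norm_nonneg _)).trans
      (hA ⟨x, rfl⟩)
  rintro T ⟨⟨f, hf, hfT⟩, g, hg, hgT⟩
  exact ⟨⟨f, key hw hf, hfT⟩, g, key hv hg, hgT⟩

/-- The union of the spaces `S^{v^λ}_{w^λ}`, `λ > 0`. -/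
noncomputable def roumieuSubmodule (V W : WeightFunctionSystem d) : Submodule ℂ 𝓢'(Rd d, ℂ) where
  carrier := {T | ∃ l : Set.Ioi (0 : ℝ), T ∈ bbSubmodule (V.weight l) (W.weight l)}
  zero_mem' := ⟨⟨1, Set.mem_Ioi.2 one_pos⟩, Submodule.zero_mem _⟩
  add_mem' := by
    rintro T U ⟨l, hT⟩ ⟨m, hU⟩
    refine ⟨max l m, Submodule.add_mem _ (bbSubmodule_le ?_ ?_ hT) (bbSubmodule_le ?_ ?_ hU)⟩
    · exact V.weight_le_weight _ _ (le_max_left _ _)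
    · exact W.weight_le_weight _ _ (le_max_left _ _)
    · exact V.weight_le_weight _ _ (le_max_right _ _)
    · exact W.weight_le_weight _ _ (le_max_right _ _)
  smul_mem' := by
    rintro c T ⟨l, hT⟩
    exact ⟨l, Submodule.smul_mem _ c hT⟩

/-- The Beurling-Björck space of Roumieu type `S^{V}_{W}`, the inductive limit of the spaces
`S^{v^λ}_{w^λ}` as `λ → ∞`. -/
def Roumieu (V W : WeightFunctionSystem d) : Type := roumieuSubmodule V W

noncomputable instance (V W : WeightFunctionSystem d) : AddCommGroup (Roumieu V W) :=
  inferInstanceAs (AddCommGroup (roumieuSubmodule V W))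

noncomputable instance (V W : WeightFunctionSystem d) : Module ℂ (Roumieu V W) :=
  inferInstanceAs (Module ℂ (roumieuSubmodule V W))

noncomputable instance (V W : WeightFunctionSystem d) : Module ℝ (Roumieu V W) :=
  Module.complexToReal _

/-- The tempered distribution underlying an element of `S^{V}_{W}`. -/
noncomputable def Roumieu.toDistribution (V W : WeightFunctionSystem d) :
    Roumieu V W →ₗ[ℂ] 𝓢'(Rd d, ℂ) :=
  (roumieuSubmodule V W).subtype

/-- The inclusion of the step `S^{v^λ}_{w^λ}` into `S^{V}_{W}`. -/
noncomputable def Roumieu.ofStep (V W : WeightFunctionSystem d) (l : Set.Ioi (0 : ℝ)) :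
    BBSpace (V.weight l) (W.weight l) →ₗ[ℂ] Roumieu V W :=
  Submodule.inclusion (show bbSubmodule (V.weight l) (W.weight l) ≤ roumieuSubmodule V W from
    fun _ hT => Exists.intro l hT)

/-- The locally convex inductive limit topology: the finest locally convex vector space topology on
`S^{V}_{W}` for which all the inclusions of the steps are continuous. -/
noncomputable instance Roumieu.instTopologicalSpace (V W : WeightFunctionSystem d) :
    TopologicalSpace (Roumieu V W) :=
  sInf {t : TopologicalSpace (Roumieu V W) |
    @IsTopologicalAddGroup (Roumieu V W) t _ ∧
    @ContinuousSMul ℂ (Roumieu V W) _ _ t ∧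
    @LocallyConvexSpace ℝ (Roumieu V W) _ _ _ _ t ∧
    ∀ l : Set.Ioi (0 : ℝ), @Continuous _ _ _ t (Roumieu.ofStep V W l)}

end Roumieu

/-! ### The projective description -/

section ProjDescr

variable {d : ℕ}

/-- The intersection of the spaces `S^v_w` over `v` and `w` in the maximal Nachbin families. -/
noncomputable def projSubmodule (V W : WeightFunctionSystem d) : Submodule ℂ 𝓢'(Rd d, ℂ) where
  carrier := {T | ∀ v ∈ V.nachbin, ∀ w ∈ W.nachbin, T ∈ bbSubmodule v w}
  zero_mem' := fun _ _ _ _ => Submodule.zero_mem _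
  add_mem' := fun hT hU v hv w hw => Submodule.add_mem _ (hT v hv w hw) (hU v hv w hw)
  smul_mem' := fun c _ hT v hv w hw => Submodule.smul_mem _ c (hT v hv w hw)

/-- The projective description of `S^{V}_{W}`. -/
def ProjDescr (V W : WeightFunctionSystem d) : Type := projSubmodule V W

noncomputable instance (V W : WeightFunctionSystem d) : AddCommGroup (ProjDescr V W) :=
  inferInstanceAs (AddCommGroup (projSubmodule V W))

noncomputable instance (V W : WeightFunctionSystem d) : Module ℂ (ProjDescr V W) :=
  inferInstanceAs (Module ℂ (projSubmodule V W))

/-- The tempered distribution underlying an element of the projective description. -/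
noncomputable def ProjDescr.toDistribution (V W : WeightFunctionSystem d) :
    ProjDescr V W →ₗ[ℂ] 𝓢'(Rd d, ℂ) :=
  (projSubmodule V W).subtype

/-- The seminorms `‖·‖_{S^v_w}` on the projective description, for `v` and `w` in the maximal
Nachbin families. -/
noncomputable def ProjDescr.seminormFamily (V W : WeightFunctionSystem d) :
    SeminormFamily ℂ (ProjDescr V W) (V.nachbin × W.nachbin) := fun vw =>
  (bbSeminorm vw.1.1 vw.2.1).comp
    (Submodule.inclusion (show projSubmodule V W ≤ bbSubmodule vw.1.1 vw.2.1 from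
      fun _ hT => hT _ vw.1.2 _ vw.2.2))

/-- The locally convex topology generated by the seminorms `‖·‖_{S^v_w}`. -/
noncomputable instance ProjDescr.instTopologicalSpace (V W : WeightFunctionSystem d) :
    TopologicalSpace (ProjDescr V W) :=
  (ProjDescr.seminormFamily V W).moduleFilterBasis.topology

end ProjDescr

end BeurlingBjorck

/-! Every Nachbin function is bounded by a multiple of every weight, so each step embeds
continuously into the projective description. This gives one inclusion and, by the universal
property of the inductive limit, its continuity. Conversely, if f were bounded against all Nachbin
functions but against no weight, there would be points x_n with |f(x_n)| w^{n+1}(x_n) > n. A Nachbin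
function that is at least w^{n+1}(x_n) at every x_n contradicts this (`exists_bddAbove_mul_weight`),
so the two sets agree.

The substance is the inverse map: a seminorm p that is continuous on all steps must be dominated by
a single seminorm of the projective description (`exists_nachbin_seminorm_le`). If the space is zero
there is nothing to do. Otherwise fix a nonzero element γ. Some time-frequency shift θ of γ pairs
nontrivially with γ, and short-time Fourier inversion writes φ as a constant multiple of ∬ Vφ(x,ξ)
γ_{x,ξ} dx dξ, where γ_{x,ξ} are the shifts of γ and Vφ is taken with window θ. The integral
converges in a Banach space into which a step embeds, and Hahn-Banach gives p(φ) ≤ const · ∬ |Vφ|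
p(γ_{x,ξ}) (`seminorm_le_integral`). The step depends on φ, but this bound does not.

By {M}, p(γ_{x,ξ}) ≤ C_m w^m(x) v^m(ξ) for every m, hence p(γ_{x,ξ}) ≤ w₀(x) v₀(ξ) with Nachbin
functions w₀, v₀ (`exists_nachbin_tensor`). On the other side, |Vφ(x,ξ)| is bounded by a convolution
of |φ| in x and by one of |φ̂| in ξ, and the arithmetic-geometric mean inequality merges the two
into decay in both variables (`norm_stft_mul_mul_le`). {N} supplies integrable h, g whose inverses
are still dominated, {Sq} pays for products and squares, and so |Vφ| p(γ_{x,ξ}) is at most a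
constant times ‖φ‖ h(x) g(ξ). -/

namespace BeurlingBjorck

/-! ### Weight systems and their Nachbin families. -/

namespace WeightFunctionSystem

variable {d : ℕ} (W : WeightFunctionSystem d)

theorem weight_pos (l : Set.Ioi (0 : ℝ)) (x : Rd d) : 0 < W.weight l x :=
  zero_lt_one.trans_le (W.one_le_weight l x)

theorem weight_ne_zero (l : Set.Ioi (0 : ℝ)) (x : Rd d) : W.weight l x ≠ 0 :=
  (W.weight_pos l x).ne'

/-- The cofinal sequence `1, 2, 3, …` of indices. -/
def natIndex (n : ℕ) : Set.Ioi (0 : ℝ) := ⟨n + 1, Set.mem_Ioi.2 (by positivity)⟩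

theorem exists_le_natIndex (l : Set.Ioi (0 : ℝ)) : ∃ n, l ≤ natIndex n := by
  obtain ⟨n, hn⟩ := exists_nat_ge (l : ℝ)
  exact ⟨n, Subtype.coe_le_coe.1 (by simp only [natIndex]; linarith)⟩

theorem natIndex_mono : Monotone natIndex := fun a b h => by
  refine Subtype.coe_le_coe.1 ?_
  simp only [natIndex]
  have : (a : ℝ) ≤ b := by exact_mod_cast h
  linarith

/-- The lower envelope of the functions `A n * w^{n+1}`. -/
noncomputable def infWeight (A : ℕ → ℝ≥0) (x : Rd d) : ℝ≥0 :=
  ⨅ n, A n * W.weight (natIndex n) x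

theorem infWeight_le (A : ℕ → ℝ≥0) (n : ℕ) (x : Rd d) :
    W.infWeight A x ≤ A n * W.weight (natIndex n) x :=
  ciInf_le (OrderBot.bddBelow _) n

/-- An infimum of continuous functions is upper semicontinuous, and the integer indices are cofinal,
so countably many bounds control all weights. -/
theorem infWeight_mem_nachbin (A : ℕ → ℝ≥0) : W.infWeight A ∈ W.nachbin := by
  refine ⟨upperSemicontinuous_ciInf (fun x => OrderBot.bddBelow _) fun n =>
    (continuous_const.mul (W.continuous_weight _)).upperSemicontinuous, fun l => ?_⟩
  obtain ⟨n, hn⟩ := exists_le_natIndex l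
  refine ⟨A n, ?_⟩
  rintro _ ⟨x, rfl⟩
  rw [div_le_iff₀ (W.weight_pos l x)]
  exact (W.infWeight_le A n x).trans (mul_le_mul_right (W.weight_le_weight _ _ hn x) _)

/-- A function is dominated by `W` if it is bounded by a multiple of each of the weights. -/
def Dominated (u : Rd d → ℝ≥0) : Prop :=
  ∀ l, ∃ C : ℝ≥0, ∀ x, u x ≤ C * W.weight l x

variable {W}

theorem dominated_of_mem_nachbin {w : Rd d → ℝ≥0} (hw : w ∈ W.nachbin) : W.Dominated w := by
  intro l
  obtain ⟨C, hC⟩ := hw.2 l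
  refine ⟨C, fun x => ?_⟩
  have := hC ⟨x, rfl⟩
  rwa [div_le_iff₀ (W.weight_pos l x)] at this

variable (W) in
/-- Given constants `C l`, some element of the Nachbin family dominates everything that is dominated
by all the functions `C l * w^l`. -/
theorem exists_nachbin_dominating (C : Set.Ioi (0 : ℝ) → ℝ≥0) :
    ∃ w ∈ W.nachbin, ∀ x y, (∀ l, y ≤ C l * W.weight l x) → y ≤ w x :=
  ⟨W.infWeight fun n => C (natIndex n), W.infWeight_mem_nachbin _, fun _ _ h =>
    le_ciInf fun n => h (natIndex n)⟩

theorem RoumieuSq.exists_sq_le (hSq : W.RoumieuSq) (n : Set.Ioi (0 : ℝ)) :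
    ∃ l, ∃ C : ℝ≥0, ∀ x, W.weight l x ^ 2 ≤ C * W.weight n x := by
  obtain ⟨l, m, C, -, h⟩ := hSq n
  refine ⟨max l m, C, fun x => le_trans ?_ (h x)⟩
  rw [sq]
  exact mul_le_mul' (W.weight_le_weight _ _ (le_max_left _ _) x)
    (W.weight_le_weight _ _ (le_max_right _ _) x)

/-- Both factors are compared with one w^l whose square {Sq} bounds by w^n. Semicontinuity plays no
role here; it is recovered in `Dominated.exists_moderate`. -/
theorem Dominated.mul (hSq : W.RoumieuSq) {u v : Rd d → ℝ≥0} (hu : W.Dominated u)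
    (hv : W.Dominated v) : W.Dominated fun x => u x * v x := by
  intro n
  obtain ⟨l, C, h⟩ := hSq.exists_sq_le n
  obtain ⟨A, hA⟩ := hu l
  obtain ⟨B, hB⟩ := hv l
  refine ⟨A * B * C, fun x => (mul_le_mul' (hA x) (hB x)).trans ?_⟩
  calc A * W.weight l x * (B * W.weight l x) = A * B * W.weight l x ^ 2 := by ring
    _ ≤ A * B * (C * W.weight n x) := mul_le_mul_right (h x) _
    _ = _ := by ring

/-- By {M} with n kept fixed, u(x+y)/w^n(y) is at most C_m w^m(x) for every m, uniformly in y, so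
one Nachbin function of x bounds it. In the convolution estimates n is dictated by the integrability
of the window. -/
theorem Dominated.exists_moderate (hM : W.RoumieuM) {u : Rd d → ℝ≥0} (hu : W.Dominated u)
    (n : Set.Ioi (0 : ℝ)) :
    ∃ w ∈ W.nachbin, ∀ x y, u (x + y) ≤ w x * W.weight n y := by
  have key : ∀ m, ∃ C : ℝ≥0, ∀ x y, u (x + y) ≤ C * W.weight m x * W.weight n y := by
    intro m
    obtain ⟨l, C, -, h⟩ := hM m n
    obtain ⟨A, hA⟩ := hu l
    refine ⟨A * C, fun x y => (hA _).trans ?_⟩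
    calc A * W.weight l (x + y) ≤ A * (C * W.weight m x * W.weight n y) :=
          mul_le_mul_right (h x y) _
      _ = _ := by ring
  choose C hC using key
  obtain ⟨w, hw, h⟩ := W.exists_nachbin_dominating C
  refine ⟨w, hw, fun x y => ?_⟩
  rw [← div_le_iff₀ (W.weight_pos n y)]
  refine h x _ fun l => ?_
  rw [div_le_iff₀ (W.weight_pos n y)]
  exact hC l x y

theorem RoumieuN.integrable_inv_weight (hN : W.RoumieuN) (m : Set.Ioi (0 : ℝ)) :
    Integrable (fun x : Rd d => ((W.weight m x)⁻¹ : ℝ)) volume := by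
  obtain ⟨l, hl⟩ := hN m
  refine hl.mono ?_ (Filter.Eventually.of_forall fun x => ?_)
  · exact (((NNReal.continuous_coe.comp (W.continuous_weight m)).inv₀
      fun x => NNReal.coe_ne_zero.2 (W.weight_ne_zero m x))).aestronglyMeasurable
  · have h1 : (1 : ℝ) ≤ W.weight l x := by exact_mod_cast W.one_le_weight l x
    have h2 : (0 : ℝ) < W.weight m x := by exact_mod_cast W.weight_pos m x
    rw [Real.norm_of_nonneg (by positivity), Real.norm_of_nonneg (by positivity), inv_eq_one_div]
    gcongr

/-- There is an everywhere positive integrable function whose inverse is dominated by `W`. -/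
theorem RoumieuN.exists_integrable_dominated_inv (hN : W.RoumieuN) :
    ∃ h : Rd d → ℝ≥0, (∀ x, h x ≠ 0) ∧ Integrable (fun x => (h x : ℝ)) volume ∧
      W.Dominated fun x => (h x)⁻¹ := by
  let I : ℕ → ENNReal := fun n => ∫⁻ x : Rd d, ((W.weight (natIndex n) x)⁻¹ : ℝ≥0)
  have hI : ∀ n, I n ≠ ⊤ := fun n => by
    have := (hN.integrable_inv_weight (natIndex n)).2
    rw [hasFiniteIntegral_iff_enorm] at this
    refine (lt_of_le_of_lt (le_of_eq (lintegral_congr fun x => ?_)) this).ne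
    rw [← NNReal.coe_inv]
    simp only [NNReal.enorm_eq]
  -- The function sought is h = ∑ δ_n / w^{n+1}. The summand `I n` makes h integrable; the added 1
  -- makes δ itself summable, so the series converges pointwise because w ≥ 1. Keeping a single term
  -- gives 1/h ≤ w^{n+1}/δ_n.
  obtain ⟨δ, hδ, hsum⟩ := ENNReal.exists_pos_tsum_mul_lt_of_countable one_ne_zero
    (fun n => 1 + I n) fun n => ENNReal.add_ne_top.2 ⟨ENNReal.one_ne_top, hI n⟩
  have hδsum : Summable δ := by
    rw [← ENNReal.tsum_coe_ne_top_iff_summable]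
    refine ne_top_of_lt (lt_of_le_of_lt (ENNReal.tsum_le_tsum fun n => ?_) hsum)
    exact le_mul_of_one_le_left (by simp) le_self_add
  let F : ℕ → Rd d → ℝ≥0 := fun n x => δ n * (W.weight (natIndex n) x)⁻¹
  have hF : ∀ x, Summable fun n => F n x := fun x =>
    NNReal.summable_of_le (fun n => mul_le_of_le_one_right' (inv_le_one_of_one_le₀
      (W.one_le_weight _ x))) hδsum
  have hFle : ∀ n x, F n x ≤ ∑' n, F n x := fun n x => (hF x).le_tsum n fun _ _ => zero_le
  have hFpos : ∀ n x, 0 < F n x := fun n x => mul_pos (hδ n) (inv_pos.2 (W.weight_pos _ x))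
  have hFm : ∀ n, Measurable (F n) := fun n =>
    (W.continuous_weight _).measurable.inv.const_mul _
  refine ⟨fun x => ∑' n, F n x, fun x => ((hFpos 0 x).trans_le (hFle 0 x)).ne', ?_, fun l => ?_⟩
  · have hm : Measurable fun x => ∑' n, F n x := by
      exact Measurable.tsum hFm
    refine ⟨hm.coe_nnreal_real.aestronglyMeasurable, ?_⟩
    rw [hasFiniteIntegral_iff_enorm]
    simp only [NNReal.enorm_eq]
    calc ∫⁻ x, ((∑' n, F n x : ℝ≥0) : ENNReal) = ∫⁻ x, ∑' n, (F n x : ENNReal) :=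
          lintegral_congr fun x => ENNReal.coe_tsum (hF x)
      _ = ∑' n, ∫⁻ x, (F n x : ENNReal) :=
          lintegral_tsum fun n => (hFm n).coe_nnreal_ennreal.aemeasurable
      _ ≤ ∑' n, (1 + I n) * δ n := ENNReal.tsum_le_tsum fun n => by
          simp only [F, ENNReal.coe_mul]
          rw [lintegral_const_mul' _ _ ENNReal.coe_ne_top, mul_comm]
          gcongr
          exact le_add_self
      _ < ⊤ := hsum.trans ENNReal.one_lt_top
  · obtain ⟨n, hn⟩ := exists_le_natIndex l
    refine ⟨(δ n)⁻¹, fun x => ?_⟩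
    calc (∑' n, F n x)⁻¹ ≤ (F n x)⁻¹ := inv_anti₀ (hFpos n x) (hFle n x)
      _ = (δ n)⁻¹ * W.weight (natIndex n) x := by simp [F, mul_comm]
      _ ≤ _ := mul_le_mul_right (W.weight_le_weight _ _ hn x) _

/-- A function of two variables that is bounded by multiples of all the products `w^l ⊗ v^l` is
bounded by a product of elements of the Nachbin families. -/
theorem exists_nachbin_tensor {V : WeightFunctionSystem d} {u : Rd d → Rd d → ℝ≥0}
    (hu : ∀ l, ∃ C : ℝ≥0, ∀ x y, u x y ≤ C * W.weight l x * V.weight l y) :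
    ∃ w ∈ W.nachbin, ∃ v ∈ V.nachbin, ∀ x y, u x y ≤ w x * v y := by
  choose C hC using hu
  -- A product of two envelopes involves independent indices i and j, while the hypothesis is used
  -- at their maximum. The factor with the larger index absorbs the constant there, and the other
  -- factor is at least 1.
  let A : ℕ → ℝ≥0 := fun n => 1 + ∑ k ∈ Finset.range (n + 1), C (natIndex k)
  have hA1 : ∀ n, 1 ≤ A n := fun n => le_self_add
  have hA : ∀ k n, k ≤ n → C (natIndex k) ≤ A n := fun k n h =>
    (Finset.single_le_sum (f := fun k => C (natIndex k)) (fun _ _ => zero_le)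
      (Finset.mem_range.2 (Nat.lt_succ_of_le h))).trans le_add_self
  refine ⟨W.infWeight A, W.infWeight_mem_nachbin A, V.infWeight A, V.infWeight_mem_nachbin A,
    fun x y => NNReal.le_iInf_mul_iInf fun i j => ?_⟩
  have key : C (natIndex (max i j)) ≤ A i * A j := by
    rcases le_total i j with h | h
    · rw [max_eq_right h]
      exact (hA j j le_rfl).trans (le_mul_of_one_le_left' (hA1 i))
    · rw [max_eq_left h]
      exact (hA i i le_rfl).trans (le_mul_of_one_le_right' (hA1 j))
  calc u x y ≤ C (natIndex (max i j)) * W.weight (natIndex (max i j)) x *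
        V.weight (natIndex (max i j)) y := hC _ x y
    _ ≤ A i * A j * W.weight (natIndex i) x * V.weight (natIndex j) y :=
        mul_le_mul' (mul_le_mul' key (W.weight_le_weight _ _ (natIndex_mono (le_max_left _ _)) x))
          (V.weight_le_weight _ _ (natIndex_mono (le_max_right _ _)) y)
    _ = _ := by ring

/-- A function that is bounded against all of the Nachbin family is bounded against one of the
weights. -/
theorem exists_bddAbove_mul_weight {f : Rd d → ℝ≥0}
    (hf : ∀ w ∈ W.nachbin, BddAbove (Set.range fun x => f x * w x)) :
    ∃ l, BddAbove (Set.range fun x => f x * W.weight l x) := by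
  by_contra! hcon
  have h : ∀ n : ℕ, ∃ x, (n : ℝ≥0) < f x * W.weight (natIndex n) x := fun n => by
    by_contra! h
    exact hcon (natIndex n) ⟨n, by rintro _ ⟨x, rfl⟩; exact h x⟩
  choose x hx using h
  -- The values w^{n+1}(x_n) are dominated by every w^l along the sequence: finitely many go into
  -- the constant since w^l ≥ 1, the rest follow from monotonicity in the index.
  have key : ∀ l, ∃ C : ℝ≥0, ∀ n,
      W.weight (natIndex n) (x n) ≤ C * W.weight l (x n) := fun l => by
    obtain ⟨N, hN⟩ := exists_le_natIndex l
    refine ⟨1 + ∑ k ∈ Finset.range N, W.weight (natIndex k) (x k), fun n => ?_⟩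
    rcases lt_or_ge n N with h | h
    · refine (Finset.single_le_sum (f := fun k => W.weight (natIndex k) (x k))
        (fun _ _ => zero_le) (Finset.mem_range.2 h)).trans (le_add_self.trans
          (le_mul_of_one_le_right' (W.one_le_weight _ _)))
    · exact (W.weight_le_weight _ _ (hN.trans (natIndex_mono h)) _).trans
        (le_mul_of_one_le_left' le_self_add)
  choose C hC using key
  obtain ⟨w, hw, hdom⟩ := W.exists_nachbin_dominating C
  obtain ⟨B, hB⟩ := hf w hw
  obtain ⟨n, hn⟩ := exists_nat_ge B
  have h1 : f (x n) * w (x n) ≤ B := hB ⟨x n, rfl⟩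
  have h2 := mul_le_mul_right (hdom (x n) _ fun l => hC l n) (f (x n))
  exact absurd (hx n) (not_lt.2 (h2.trans (h1.trans hn)))

/-- The weights tend to infinity at infinity. -/
theorem tendsto_inv_weight (hM : W.RoumieuM) (hN : W.RoumieuN) (m : Set.Ioi (0 : ℝ)) :
    Filter.Tendsto (fun x => ((W.weight m x)⁻¹ : ℝ)) (Filter.cocompact (Rd d)) (nhds 0) := by
  -- By {M} and compactness of the unit ball, 1/w^m(x) is at most a constant times the integral of
  -- 1/w^l over the unit ball around x, which vanishes at infinity because 1/w^l is integrable.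
  obtain ⟨l, C, -, hC⟩ := hM m m
  obtain ⟨A, hA⟩ : ∃ A : ℝ≥0, ∀ y ∈ Metric.closedBall (0 : Rd d) 1, W.weight m y ≤ A := by
    obtain ⟨A, hA⟩ := ((isCompact_closedBall (0 : Rd d) 1).image
      (W.continuous_weight m)).bddAbove
    exact ⟨A, fun y hy => hA ⟨y, hy, rfl⟩⟩
  have hint := hN.integrable_inv_weight l
  rw [← Metric.cobounded_eq_cocompact]
  have h1 : Filter.Tendsto (fun x : Rd d => ∫ t, (Metric.closedBall x 1).indicator
      (fun t => ((W.weight l t)⁻¹ : ℝ)) t) (Bornology.cobounded (Rd d)) (nhds 0) := by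
    have : (Bornology.cobounded (Rd d)).IsCountablyGenerated := by
      rw [← comap_norm_atTop]; infer_instance
    rw [← integral_zero (Rd d) ℝ (μ := volume)]
    refine tendsto_integral_filter_of_dominated_convergence
      (fun t => ((W.weight l t)⁻¹ : ℝ)) ?_ ?_ hint ?_
    · exact Filter.Eventually.of_forall fun x =>
        hint.aestronglyMeasurable.indicator measurableSet_closedBall
    · refine Filter.Eventually.of_forall fun x => Filter.Eventually.of_forall fun t => ?_
      refine (norm_indicator_le_norm_self _ _).trans (le_of_eq (Real.norm_of_nonneg ?_))
      positivity
    · refine Filter.Eventually.of_forall fun t => tendsto_const_nhds.congr' ?_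
      have : ∀ᶠ x in Bornology.cobounded (Rd d), x ∉ Metric.closedBall t 1 :=
        Bornology.isBounded_def.1 Metric.isBounded_closedBall
      filter_upwards [this] with x hx
      rw [Set.indicator_of_notMem]
      rwa [Metric.mem_closedBall, dist_comm, ← Metric.mem_closedBall]
  set b : ℝ := (volume (Metric.closedBall (0 : Rd d) 1)).toReal with hb
  have hbpos : 0 < b := ENNReal.toReal_pos (Metric.measure_closedBall_pos _ _ one_pos).ne'
    measure_closedBall_lt_top.ne
  have h2 : ∀ x, ((W.weight m x)⁻¹ : ℝ) ≤ (C * A / b : ℝ) * ∫ t, (Metric.closedBall x 1).indicator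
      (fun t => ((W.weight l t)⁻¹ : ℝ)) t := fun x => by
    have hx : (0 : ℝ) < W.weight m x := by exact_mod_cast W.weight_pos m x
    have h3 : ∫ t, (Metric.closedBall x 1).indicator (fun _ => ((W.weight m x)⁻¹ : ℝ)) t ≤
        ∫ t, (C * A : ℝ) * (Metric.closedBall x 1).indicator
          (fun t => ((W.weight l t)⁻¹ : ℝ)) t := by
      refine integral_mono ((integrable_indicator_iff measurableSet_closedBall).2
        (integrableOn_const measure_closedBall_lt_top.ne)) ((hint.indicator
          measurableSet_closedBall).const_mul _) fun t => ?_
      by_cases ht : t ∈ Metric.closedBall x 1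
      · simp only [Set.indicator_of_mem ht]
        have h4 := hC x (t - x)
        have h5 := hA (t - x) (by simpa [dist_eq_norm] using ht)
        rw [add_sub_cancel] at h4
        have h6 : W.weight l t ≤ C * W.weight m x * A := h4.trans (mul_le_mul_right h5 _)
        have h7 : (W.weight l t : ℝ) ≤ C * W.weight m x * A := by exact_mod_cast h6
        have h8 : (0 : ℝ) < W.weight l t := by exact_mod_cast W.weight_pos l t
        rw [inv_le_iff_one_le_mul₀ hx, mul_assoc, mul_comm _ (W.weight m x : ℝ), ← mul_assoc,
          ← div_eq_mul_inv, le_div_iff₀ h8]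
        linarith
      · simp [Set.indicator_of_notMem ht]
    rw [integral_indicator measurableSet_closedBall, setIntegral_const, integral_const_mul,
      Measure.real, Measure.addHaar_closedBall_center, ← hb, smul_eq_mul] at h3
    rw [div_mul_eq_mul_div, le_div_iff₀ hbpos]
    linarith
  refine squeeze_zero (fun x => by positivity) h2 ?_
  simpa using h1.const_mul (C * A / b : ℝ)

end WeightFunctionSystem

/-! ### Density of compactly supported functions in the Schwartz space. -/

section CompactSupport

variable {d : ℕ}

/-- The derivatives of the function `1 - χ`, where `χ` is a bump function, are bounded. -/
theorem exists_bound_iteratedFDeriv_one_sub_bump (χ : ContDiffBump (0 : Rd d)) (i : ℕ) :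
    ∃ M : ℝ, 0 ≤ M ∧ ∀ x, ‖iteratedFDeriv ℝ i (fun z => 1 - χ z) x‖ ≤ M := by
  have hcont : Continuous (iteratedFDeriv ℝ i χ) :=
    (χ.contDiff (n := (i : ℕ∞))).continuous_iteratedFDeriv le_rfl
  obtain ⟨M, hM⟩ := hcont.bounded_above_of_compact_support (χ.hasCompactSupport.iteratedFDeriv i)
  have hM0 : 0 ≤ M := (norm_nonneg _).trans (hM 0)
  refine ⟨1 + M, by positivity, fun x => ?_⟩
  have h1 : iteratedFDeriv ℝ i (fun z => 1 - χ z) x =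
      iteratedFDeriv ℝ i (fun _ => (1 : ℝ)) x - iteratedFDeriv ℝ i χ x :=
    iteratedFDeriv_sub_apply contDiff_const.contDiffAt (χ.contDiff (n := (i : ℕ∞))).contDiffAt
  rw [h1]
  refine (norm_sub_le _ _).trans (add_le_add ?_ (hM x))
  rcases Nat.eq_zero_or_pos i with rfl | hi
  · simp
  · rw [iteratedFDeriv_const_of_ne hi.ne']
    simp

/-- The factor 1 - χ(x/R) vanishes for ‖x‖ < R·`rIn`; elsewhere one extra power of ‖x‖ buys the
factor 1/R. As R ≥ 1, the rescaling does not enlarge the bounds on the derivatives. -/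
theorem seminorm_bump_smul_sub_le (χ : ContDiffBump (0 : Rd d)) (u : 𝓢(Rd d, ℂ)) (k n : ℕ) :
    ∃ K : ℝ, ∀ R : ℝ, 1 ≤ R → ∀ v : 𝓢(Rd d, ℂ), (∀ x, v x = (χ (R⁻¹ • x) : ℝ) • u x) →
      SchwartzMap.seminorm ℝ k n (u - v) ≤ K / R := by
  choose M hM0 hM using exists_bound_iteratedFDeriv_one_sub_bump χ
  let K : ℝ := ∑ i ∈ Finset.range (n + 1), (n.choose i : ℝ) * M i *
    SchwartzMap.seminorm ℝ (k + 1) (n - i) u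
  have hr := χ.rIn_pos
  have hK : 0 ≤ K := Finset.sum_nonneg fun i _ => mul_nonneg (mul_nonneg (by positivity) (hM0 i))
    (apply_nonneg _ _)
  refine ⟨K / χ.rIn, fun R hR v hv => ?_⟩
  have hR0 : 0 < R := by positivity
  refine SchwartzMap.seminorm_le_bound ℝ k n _ (by positivity) fun x => ?_
  have huv : ⇑(u - v) = fun x => (1 - χ (R⁻¹ • x)) • u x := by
    ext y
    simp [hv, sub_mul]
  rw [huv]
  rcases lt_or_ge ‖x‖ (R * χ.rIn) with hx | hx
  · have hz : (fun x => (1 - χ (R⁻¹ • x)) • u x) =ᶠ[nhds x] fun _ => 0 := by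
      filter_upwards [(isOpen_lt continuous_norm continuous_const).mem_nhds hx] with y hy
      rw [χ.one_of_mem_closedBall, sub_self, zero_smul]
      rw [mem_closedBall_zero_iff, norm_smul, norm_inv, Real.norm_of_nonneg hR0.le,
        inv_mul_le_iff₀ hR0]
      exact le_of_lt hy
    rw [hz.iteratedFDeriv ℝ n |>.eq_of_nhds]
    have : iteratedFDeriv ℝ n (fun _ : Rd d => (0 : ℂ)) x = 0 := by
      change iteratedFDeriv ℝ n (0 : Rd d → ℂ) x = 0
      simp
    rw [this]
    simp only [norm_zero, mul_zero]
    positivity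
  · have hb : ContDiff ℝ n fun z => 1 - χ z := contDiff_const.sub (χ.contDiff (n := (n : ℕ∞)))
    have hb' : ContDiff ℝ n fun x => 1 - χ (R⁻¹ • x) := hb.comp (contDiff_const_smul _)
    have h1 := norm_iteratedFDeriv_smul_le hb' (u.smooth n) x le_rfl
    have h2 : ∀ i ∈ Finset.range (n + 1), ‖x‖ ^ k * ((n.choose i : ℝ) *
        ‖iteratedFDeriv ℝ i (fun x => 1 - χ (R⁻¹ • x)) x‖ * ‖iteratedFDeriv ℝ (n - i) u x‖) ≤
        ((n.choose i : ℝ) * M i * SchwartzMap.seminorm ℝ (k + 1) (n - i) u) / (R * χ.rIn) := by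
      intro i hi
      have hin : (i : WithTop ℕ∞) ≤ n := by
        exact_mod_cast Nat.lt_succ_iff.1 (Finset.mem_range.1 hi)
      have h3 : ‖iteratedFDeriv ℝ i (fun x => 1 - χ (R⁻¹ • x)) x‖ ≤ M i := by
        rw [iteratedFDeriv_comp_const_smul (f := fun z => 1 - χ z) R⁻¹ (hb.of_le hin), norm_smul,
          norm_pow, norm_inv, Real.norm_of_nonneg hR0.le]
        exact (mul_le_of_le_one_left (norm_nonneg _)
          (pow_le_one₀ (by positivity) (inv_le_one_of_one_le₀ hR))).trans (hM i _)
      have h4 := SchwartzMap.le_seminorm ℝ (k + 1) (n - i) u x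
      rw [le_div_iff₀ (by positivity)]
      calc _ = (n.choose i : ℝ) * ‖iteratedFDeriv ℝ i (fun x => 1 - χ (R⁻¹ • x)) x‖ *
            (‖x‖ ^ k * (R * χ.rIn) * ‖iteratedFDeriv ℝ (n - i) u x‖) := by ring
        _ ≤ (n.choose i : ℝ) * M i * (‖x‖ ^ (k + 1) * ‖iteratedFDeriv ℝ (n - i) u x‖) := by
            have := hM0 i
            rw [pow_succ]
            gcongr
        _ ≤ _ := by
            have := hM0 i
            gcongr
    calc _ ≤ ‖x‖ ^ k * ∑ i ∈ Finset.range (n + 1), (n.choose i : ℝ) *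
          ‖iteratedFDeriv ℝ i (fun x => 1 - χ (R⁻¹ • x)) x‖ * ‖iteratedFDeriv ℝ (n - i) u x‖ := by
          gcongr
      _ ≤ ∑ i ∈ Finset.range (n + 1), ((n.choose i : ℝ) * M i *
            SchwartzMap.seminorm ℝ (k + 1) (n - i) u) / (R * χ.rIn) := by
          rw [Finset.mul_sum]
          exact Finset.sum_le_sum h2
      _ = K / χ.rIn / R := by
          rw [← Finset.sum_div, div_div, mul_comm R]

/-- The compactly supported functions are dense in the Schwartz space. -/
theorem dense_hasCompactSupport : Dense {u : 𝓢(Rd d, ℂ) | HasCompactSupport u} := by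
  intro u
  let χ : ContDiffBump (0 : Rd d) := ⟨1, 2, one_pos, one_lt_two⟩
  have hs : ∀ n : ℕ, HasCompactSupport fun x => (χ (((n : ℝ) + 1)⁻¹ • x) : ℝ) • u x := fun n =>
    (χ.hasCompactSupport.comp_smul (c := ((n : ℝ) + 1)⁻¹) (by positivity)).smul_right
  have hd : ∀ n : ℕ, ContDiff ℝ (↑(⊤ : ℕ∞)) fun x => (χ (((n : ℝ) + 1)⁻¹ • x) : ℝ) • u x :=
    fun n => ((χ.contDiff (n := ⊤)).comp (contDiff_const_smul _)).smul u.smooth'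
  refine mem_closure_of_tendsto (f := fun n => (hs n).toSchwartzMap (hd n)) (b := Filter.atTop) ?_
    (Filter.Eventually.of_forall fun n => hs n)
  rw [(schwartz_withSeminorms ℝ (Rd d) ℂ).tendsto_nhds_atTop]
  rintro ⟨k, n⟩ ε hε
  obtain ⟨K, hK⟩ := seminorm_bump_smul_sub_le χ u k n
  obtain ⟨N, hN⟩ := exists_nat_gt (K / ε)
  refine ⟨N, fun m hm => ?_⟩
  have hm' : (N : ℝ) ≤ m := by exact_mod_cast hm
  rw [map_sub_rev]
  refine (hK (m + 1) (by linarith [(Nat.cast_nonneg m : (0 : ℝ) ≤ m)]) _ fun x => rfl).trans_lt ?_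
  rw [div_lt_iff₀ (by positivity)]
  rw [div_lt_iff₀ hε] at hN
  nlinarith

end CompactSupport

/-! ### Integrable functions as tempered distributions and their Fourier transforms. -/

section Integrable

variable {d : ℕ}

/-- The tempered distribution given by an integrable function. -/
noncomputable def ofIntegrable (f : Rd d → ℂ) (hf : Integrable f) : 𝓢'(Rd d, ℂ) :=
  ((memLp_one_iff_integrable.2 hf).toLp f : Lp ℂ 1 (volume : Measure (Rd d)))

theorem ofIntegrable_apply {f : Rd d → ℂ} (hf : Integrable f) (u : 𝓢(Rd d, ℂ)) :
    ofIntegrable f hf u = ∫ x, u x * f x := by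
  rw [ofIntegrable, Lp.toTemperedDistribution_apply]
  refine integral_congr_ae ?_
  filter_upwards [(memLp_one_iff_integrable.2 hf).coeFn_toLp] with x hx
  rw [hx, smul_eq_mul]

theorem represents_ofIntegrable (f : C(Rd d, ℂ)) (hf : Integrable f) :
    Represents f (ofIntegrable f hf) := fun u _ => ofIntegrable_apply hf u

/-- A tempered distribution that is an integrable continuous function on compactly supported test
functions is this function. -/
theorem Represents.eq_ofIntegrable {f : C(Rd d, ℂ)} {T : 𝓢'(Rd d, ℂ)} (h : Represents f T)
    (hf : Integrable f) : T = ofIntegrable f hf := by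
  have key : (fun u : 𝓢(Rd d, ℂ) => T u) = fun u => ofIntegrable f hf u :=
    Continuous.ext_on dense_hasCompactSupport (map_continuous T)
      (map_continuous (ofIntegrable f hf)) fun u hu =>
        (h u hu).trans (ofIntegrable_apply hf u).symm
  exact DFunLike.ext _ _ fun u => congrFun key u

theorem continuous_fourier {f : Rd d → ℂ} (hf : Integrable f) : Continuous (𝓕 f) :=
  VectorFourier.fourierIntegral_continuous Real.continuous_fourierChar
    (innerSL ℝ).continuous₂ hf

theorem fourier_ofIntegrable_apply {f : Rd d → ℂ} (hf : Integrable f) (u : 𝓢(Rd d, ℂ)) :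
    (𝓕 (ofIntegrable f hf)) u = ∫ x, u x * 𝓕 f x := by
  rw [TemperedDistribution.fourier_apply, ofIntegrable_apply, SchwartzMap.fourier_coe]
  have := VectorFourier.integral_fourierIntegral_smul_eq_flip (μ := (volume : Measure (Rd d)))
    (ν := (volume : Measure (Rd d))) (L := innerₗ (Rd d)) (f := u) (g := f)
    Real.continuous_fourierChar (innerSL ℝ).continuous₂ u.integrable hf
  rw [flip_innerₗ] at this
  exact this

theorem represents_fourier_ofIntegrable {f : Rd d → ℂ} (hf : Integrable f) :
    Represents ⟨𝓕 f, continuous_fourier hf⟩ (𝓕 (ofIntegrable f hf)) :=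
  fun u _ => fourier_ofIntegrable_apply hf u

/-- `Represents` tests only compactly supported functions, so density is needed first to identify T
with f on all Schwartz functions; then the distributional transform is the integral one. -/
theorem Represents.fourier_eq {f g : C(Rd d, ℂ)} {T : 𝓢'(Rd d, ℂ)} (hf : Represents f T)
    (hg : Represents g (𝓕 T)) (hfi : Integrable f) : 𝓕 (f : Rd d → ℂ) = g := by
  rw [hf.eq_ofIntegrable hfi] at hg
  exact congrArg DFunLike.coe ((represents_fourier_ofIntegrable hfi).unique hg)

end Integrable

/-! ### Short-time Fourier transform and its inversion. -/

section ShortTimeFourierTransform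

open ComplexConjugate
open scoped RealInnerProductSpace

variable {d : ℕ}

/-- A continuous integrable function with integrable Fourier transform. -/
structure FourierIntegrable (f : Rd d → ℂ) : Prop where
  continuous : Continuous f
  integrable : Integrable f
  integrable_fourier : Integrable (𝓕 f)

namespace FourierIntegrable

variable {f θ γ : Rd d → ℂ}

theorem fourierInv_fourier (hf : FourierIntegrable f) : 𝓕⁻ (𝓕 f) = f :=
  hf.continuous.fourierInv_fourier_eq hf.integrable hf.integrable_fourier

theorem continuous_fourier (hf : FourierIntegrable f) : Continuous (𝓕 f) :=
  BeurlingBjorck.continuous_fourier hf.integrable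

theorem exists_bound (hf : FourierIntegrable f) : ∃ B : ℝ, ∀ x, ‖f x‖ ≤ B := by
  refine ⟨∫ x, ‖𝓕 f x‖, fun x => ?_⟩
  rw [← congrFun hf.fourierInv_fourier x, Real.fourierInv_eq]
  refine (norm_integral_le_integral_norm _).trans (le_of_eq ?_)
  simp_rw [Circle.norm_smul]

theorem integrable_mul_conj (hf : FourierIntegrable f) (hθ : FourierIntegrable θ) (x : Rd d) :
    Integrable fun s => f s * conj (θ (x - s)) := by
  obtain ⟨B, hB⟩ := hθ.exists_bound
  have hc : Continuous fun s => conj (θ (x - s)) :=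
    Complex.continuous_conj.comp (hθ.continuous.comp (continuous_const.sub continuous_id))
  exact hf.integrable.mul_bdd (c := B) hc.aestronglyMeasurable
    (Filter.Eventually.of_forall fun s => by simpa using hB (x - s))

end FourierIntegrable

/-- The short-time Fourier transform of `f` with window `s ↦ θ (-s)`. -/
noncomputable def stft (f θ : Rd d → ℂ) (x ξ : Rd d) : ℂ :=
  𝓕 (fun s => f s * conj (θ (x - s))) ξ

/-- The time-frequency shift of `γ` by `(x, ξ)`. -/
noncomputable def atom (γ : Rd d → ℂ) (x ξ t : Rd d) : ℂ :=
  Real.fourierChar ⟪t, ξ⟫ * γ (t - x)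

variable {f θ γ : Rd d → ℂ}

theorem norm_stft_le (x ξ : Rd d) :
    ‖stft f θ x ξ‖ ≤ ∫ t, ‖f t‖ * ‖θ (x - t)‖ := by
  rw [stft, Real.fourier_eq]
  refine (norm_integral_le_integral_norm _).trans (le_of_eq ?_)
  simp [Circle.norm_smul]

/-- The substitution s = x - u produces the conjugate of an integral for θ̂ at ξ - η, times a phase
that carries all dependence on x. -/
theorem norm_fourierInv_conj_comp_sub (x ξ η : Rd d) :
    ‖𝓕⁻ (fun s => Real.fourierChar (-⟪s, ξ⟫) • conj (θ (x - s))) η‖ = ‖𝓕 θ (ξ - η)‖ := by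
  rw [Real.fourierInv_eq, Real.fourier_eq, ← integral_sub_left_eq_self _ volume x]
  have h : ∀ u, Real.fourierChar ⟪x - u, η⟫ • Real.fourierChar (-⟪x - u, ξ⟫) •
      conj (θ (x - (x - u))) = (Real.fourierChar ⟪x, η - ξ⟫ : ℂ) *
        conj (Real.fourierChar (-⟪u, ξ - η⟫) • θ u) := fun u => by
    rw [sub_sub_cancel, smul_smul, ← AddChar.map_add_eq_mul, Circle.smul_def, Circle.smul_def,
      smul_eq_mul, smul_eq_mul, map_mul, ← Circle.coe_inv_eq_conj, ← AddChar.map_neg_eq_inv,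
      ← mul_assoc, ← Circle.coe_mul, ← AddChar.map_add_eq_mul]
    congr 3
    simp only [inner_sub_left, inner_sub_right]
    ring_nf
  simp_rw [h]
  rw [integral_const_mul, norm_mul, Circle.norm_coe, one_mul, integral_conj, RCLike.norm_conj]

/-- The frequency-side counterpart of `norm_stft_le`: f is written as a double Fourier transform and
one transform is moved by Fubini onto the shifted window. -/
theorem norm_stft_le_fourier (hf : FourierIntegrable f) (hθ : FourierIntegrable θ) (x ξ : Rd d) :
    ‖stft f θ x ξ‖ ≤ ∫ η, ‖𝓕 f η‖ * ‖𝓕 θ (ξ - η)‖ := by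
  let H : Rd d → ℂ := fun s => Real.fourierChar (-⟪s, ξ⟫) • conj (θ (x - s))
  have hH : Integrable H := by
    have h1 : Integrable fun s => conj (θ (x - s)) :=
      (Complex.conjCLE.integrable_comp_iff).2 (hθ.integrable.comp_sub_left x)
    exact (Real.fourierIntegral_convergent_iff ξ).2 h1
  have h1 : stft f θ x ξ = ∫ s, 𝓕 (𝓕 f) (-s) * H s := by
    rw [stft, Real.fourier_eq]
    refine integral_congr_ae (Filter.Eventually.of_forall fun s => ?_)
    simp only [H]
    rw [← Real.fourierInv_eq_fourier_neg, hf.fourierInv_fourier, mul_smul_comm]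
  have h2 : stft f θ x ξ = ∫ η, 𝓕 f η * 𝓕⁻ H η := by
    rw [h1, Real.fourierInv_eq_fourier_comp_neg,
      ← integral_neg_eq_self (fun s => 𝓕 (𝓕 f) (-s) * H s)]
    simp only [neg_neg]
    have := VectorFourier.integral_fourierIntegral_smul_eq_flip (μ := (volume : Measure (Rd d)))
      (ν := (volume : Measure (Rd d))) (L := innerₗ (Rd d)) (f := 𝓕 f) (g := fun s => H (-s))
      Real.continuous_fourierChar (innerSL ℝ).continuous₂ hf.integrable_fourier hH.comp_neg
    rw [flip_innerₗ] at this
    exact this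
  rw [h2]
  refine (norm_integral_le_integral_norm _).trans (le_of_eq ?_)
  refine integral_congr_ae (Filter.Eventually.of_forall fun η => ?_)
  simp only [norm_mul, H, norm_fourierInv_conj_comp_sub]

theorem continuous_stft (hf : FourierIntegrable f) (hθ : FourierIntegrable θ) :
    Continuous fun p : Rd d × Rd d => stft f θ p.1 p.2 := by
  obtain ⟨B, hB⟩ := hθ.exists_bound
  have hcf := hf.continuous
  have hcθ := hθ.continuous
  have hch := Real.continuous_fourierChar
  simp only [stft, Real.fourier_eq, Circle.smul_def]
  refine continuous_of_dominated (bound := fun s => ‖f s‖ * B) (fun p => ?_) (fun p => ?_)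
    (hf.integrable.norm.mul_const B) (Filter.Eventually.of_forall fun s => ?_)
  · refine Continuous.aestronglyMeasurable ?_
    fun_prop
  · refine Filter.Eventually.of_forall fun s => ?_
    simp only [norm_smul, Circle.norm_coe, one_mul, norm_mul, RCLike.norm_conj]
    exact mul_le_mul_of_nonneg_left (hB _) (norm_nonneg _)
  · fun_prop

theorem continuous_atom (hγ : Continuous γ) :
    Continuous fun p : (Rd d × Rd d) × Rd d => atom γ p.1.1 p.1.2 p.2 := by
  have hch := Real.continuous_fourierChar
  unfold atom
  fun_prop

theorem norm_atom (x ξ t : Rd d) : ‖atom γ x ξ t‖ = ‖γ (t - x)‖ := by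
  rw [atom, norm_mul, Circle.norm_coe, one_mul]

theorem fourier_atom (x ξ η : Rd d) :
    𝓕 (atom γ x ξ) η = Real.fourierChar (-⟪x, η - ξ⟫) * 𝓕 γ (η - ξ) := by
  rw [Real.fourier_eq, Real.fourier_eq, ← integral_add_right_eq_self _ x, ← integral_const_mul]
  refine integral_congr_ae (Filter.Eventually.of_forall fun u => ?_)
  simp only [atom, add_sub_cancel_right, Circle.smul_def, smul_eq_mul]
  rw [← mul_assoc, ← mul_assoc, ← Circle.coe_mul, ← Circle.coe_mul, ← AddChar.map_add_eq_mul,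
    ← AddChar.map_add_eq_mul]
  congr 3
  simp only [inner_add_left, inner_sub_right]
  ring

theorem norm_fourier_atom (x ξ η : Rd d) : ‖𝓕 (atom γ x ξ) η‖ = ‖𝓕 γ (η - ξ)‖ := by
  rw [fourier_atom, norm_mul, Circle.norm_coe, one_mul]

theorem continuous_fourier_atom (hγ : Continuous (𝓕 γ)) :
    Continuous fun p : (Rd d × Rd d) × Rd d => 𝓕 (atom γ p.1.1 p.1.2) p.2 := by
  have hch := Real.continuous_fourierChar
  simp only [fourier_atom]
  fun_prop

theorem continuous_atom_right (hγ : Continuous γ) (x ξ : Rd d) : Continuous (atom γ x ξ) := by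
  have hch := Real.continuous_fourierChar
  unfold atom
  fun_prop

theorem continuous_atom_left (hγ : Continuous γ) (t : Rd d) :
    Continuous fun p : Rd d × Rd d => atom γ p.1 p.2 t := by
  have hch := Real.continuous_fourierChar
  unfold atom
  fun_prop

theorem FourierIntegrable.atom_right (hγ : FourierIntegrable γ) (x ξ : Rd d) :
    FourierIntegrable (atom γ x ξ) := by
  have hi : Integrable (atom γ x ξ) := (hγ.integrable.comp_sub_right x).norm.mono'
    (continuous_atom_right hγ.continuous x ξ).aestronglyMeasurable
    (Filter.Eventually.of_forall fun t => (norm_atom x ξ t).le)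
  exact ⟨continuous_atom_right hγ.continuous x ξ, hi,
    (hγ.integrable_fourier.comp_sub_right ξ).norm.mono'
      (BeurlingBjorck.continuous_fourier hi).aestronglyMeasurable
      (Filter.Eventually.of_forall fun t => (norm_fourier_atom x ξ t).le)⟩

/-- The pairing of the analysis window with the synthesis window. -/
noncomputable def windowPairing (θ γ : Rd d → ℂ) : ℂ := ∫ y, conj (θ (-y)) * γ y

/-- For almost every x the slice in ξ is integrable, so Fourier inversion in ξ returns f(t) times
the conjugate of θ(x - t); the remaining integral over x is the window pairing. -/
theorem integral_stft_mul_atom (hf : FourierIntegrable f) (hθ : FourierIntegrable θ)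
    (hγ : FourierIntegrable γ)
    (hS : Integrable (fun p : Rd d × Rd d => stft f θ p.1 p.2) volume) (t : Rd d) :
    ∫ p : Rd d × Rd d, stft f θ p.1 p.2 * atom γ p.1 p.2 t = f t * windowPairing θ γ := by
  obtain ⟨B, hB⟩ := hγ.exists_bound
  have hcont := continuous_atom_left hγ.continuous t
  have hint : Integrable (fun p : Rd d × Rd d => stft f θ p.1 p.2 * atom γ p.1 p.2 t) volume :=
    hS.mul_bdd (c := B) hcont.aestronglyMeasurable
      (Filter.Eventually.of_forall fun p => (norm_atom _ _ _).le.trans (hB _))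
  rw [Measure.volume_eq_prod] at hint hS ⊢
  rw [integral_prod _ hint]
  have h1 : ∀ᵐ x : Rd d, ∫ ξ, stft f θ x ξ * atom γ x ξ t =
      f t * (conj (θ (-(t - x))) * γ (t - x)) := by
    filter_upwards [hS.prod_right_ae] with x hx
    have h2 := (hf.integrable_mul_conj hθ x).fourierInv_fourier_eq (v := t) hx
      (hf.continuous.mul (Complex.continuous_conj.comp (hθ.continuous.comp
        (continuous_const.sub continuous_id)))).continuousAt
    rw [neg_sub, ← mul_assoc, ← h2, Real.fourierInv_eq, ← integral_mul_const]
    refine integral_congr_ae (Filter.Eventually.of_forall fun ξ => ?_)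
    simp only [atom, stft, Circle.smul_def, smul_eq_mul, real_inner_comm t ξ]
    ring
  rw [integral_congr_ae h1, integral_const_mul, windowPairing,
    integral_sub_left_eq_self (fun y => conj (θ (-y)) * γ y) volume t]

/-- Fubini reduces this to `integral_stft_mul_atom`, since the shifts of γ all have the same L¹
norm. -/
theorem integral_stft_mul_fourier_atom (hf : FourierIntegrable f) (hθ : FourierIntegrable θ)
    (hγ : FourierIntegrable γ)
    (hS : Integrable (fun p : Rd d × Rd d => stft f θ p.1 p.2) volume) (η : Rd d) :
    ∫ p : Rd d × Rd d, stft f θ p.1 p.2 * 𝓕 (atom γ p.1 p.2) η =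
      𝓕 f η * windowPairing θ γ := by
  have hch := Real.continuous_fourierChar
  let G : Rd d × Rd d → Rd d → ℂ := fun p t =>
    stft f θ p.1 p.2 * (Real.fourierChar (-⟪t, η⟫) • atom γ p.1 p.2 t)
  have hG : Integrable (Function.uncurry G) (volume.prod volume) := by
    have hc : Continuous (Function.uncurry G) := by
      have h1 := (continuous_stft hf hθ).comp (continuous_fst (X := Rd d × Rd d) (Y := Rd d))
      have h2 := continuous_atom hγ.continuous
      simp only [G, Function.uncurry_def, Circle.smul_def]
      fun_prop
    refine (integrable_prod_iff hc.aestronglyMeasurable).2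
      ⟨Filter.Eventually.of_forall fun p => ?_, ?_⟩
    · exact ((Real.fourierIntegral_convergent_iff η).2
        (hγ.atom_right p.1 p.2).integrable).const_mul (stft f θ p.1 p.2)
    · have h3 : ∀ p : Rd d × Rd d, ∫ t, ‖Function.uncurry G (p, t)‖ =
          ‖stft f θ p.1 p.2‖ * ∫ t, ‖γ t‖ := fun p => by
        simp only [G, Function.uncurry_apply_pair, norm_mul, Circle.norm_smul, norm_atom]
        rw [integral_const_mul, integral_sub_right_eq_self (fun t => ‖γ t‖) p.1]
      simp_rw [h3]
      exact hS.norm.mul_const _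
  calc ∫ p : Rd d × Rd d, stft f θ p.1 p.2 * 𝓕 (atom γ p.1 p.2) η = ∫ p, ∫ t, G p t := by
        simp only [G, integral_const_mul, Real.fourier_eq]
    _ = ∫ t, ∫ p, G p t := integral_integral_swap hG
    _ = ∫ t, Real.fourierChar (-⟪t, η⟫) • f t * windowPairing θ γ := by
        refine integral_congr_ae (Filter.Eventually.of_forall fun t => ?_)
        simp only [G, mul_smul_comm, smul_mul_assoc, Circle.smul_def]
        rw [integral_smul, integral_stft_mul_atom hf hθ hγ hS]
    _ = _ := by rw [integral_mul_const, Real.fourier_eq]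

/-- For a nonzero synthesis window, one of its time-frequency shifts is an admissible analysis
window. -/
theorem exists_windowPairing_ne_zero (hγ : FourierIntegrable γ) {y₀ : Rd d} (h₀ : γ y₀ ≠ 0) :
    ∃ a ζ, windowPairing (atom γ a ζ) γ ≠ 0 := by
  by_contra! hcon
  -- The shift by -2y₀ is chosen so that the reflection fixes y₀, whence h(y₀) = |γ(y₀)|². The
  -- pairings with the shifts in frequency are the values of ĥ; if all vanish, inversion gives h(y₀)
  -- = 0.
  let h : Rd d → ℂ := fun y => γ y * conj (γ (-((-2 : ℝ) • y₀) - y))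
  have hc : Continuous h := hγ.continuous.mul
    (Complex.continuous_conj.comp (hγ.continuous.comp (continuous_const.sub continuous_id)))
  have hi : Integrable h := hγ.integrable_mul_conj hγ _
  have hz : 𝓕 h = 0 := by
    ext ζ
    have h1 := hcon ((-2 : ℝ) • y₀) (-ζ)
    rw [Pi.zero_apply, ← h1, windowPairing, Real.fourier_eq]
    refine integral_congr_ae (Filter.Eventually.of_forall fun y => ?_)
    simp only [h, atom, map_mul, Circle.smul_def, smul_eq_mul, ← Circle.coe_inv_eq_conj,
      ← AddChar.map_neg_eq_inv, inner_neg_neg]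
    rw [show -y - (-2 : ℝ) • y₀ = -((-2 : ℝ) • y₀) - y by abel]
    ring
  have h2 : h y₀ = 0 := by
    rw [← hi.fourierInv_fourier_eq (by rw [hz]; exact integrable_zero _ _ _) hc.continuousAt, hz]
    simp [Real.fourierInv_eq]
  have h3 : -((-2 : ℝ) • y₀) - y₀ = y₀ := by
    rw [neg_smul, neg_neg, two_smul]; abel
  simp only [h, h3, Complex.mul_conj] at h2
  exact h₀ (by simpa using h2)

end ShortTimeFourierTransform

/-! ### Seminorms of vector-valued integrals. -/

section SeminormIntegral

/-- A linear map into a normed space through which a seminorm is controlled allows to extend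
Hahn-Banach functionals. -/
theorem exists_dual_comp_le_seminorm {X Y : Type*} [AddCommGroup Y] [Module ℝ Y]
    [NormedAddCommGroup X] [NormedSpace ℝ X] (J : Y →ₗ[ℝ] X) (q : Seminorm ℝ Y) {C : ℝ}
    (hC : ∀ y, q y ≤ C * ‖J y‖) (φ : Y) :
    ∃ L : X →L[ℝ] ℝ, L (J φ) = q φ ∧ ∀ y, L (J y) ≤ q y := by
  obtain ⟨L, hL, hLq⟩ := exists_extension_of_le_sublinear
    (LinearPMap.mkSpanSingleton' φ (q φ) fun c hc => by
      have h1 := map_smul_eq_mul q c φ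
      rw [hc, map_zero] at h1
      rcases mul_eq_zero.1 h1.symm with h2 | h2
      · rw [norm_eq_zero.1 h2, map_zero, zero_smul]
      · rw [h2, smul_zero])
    q (fun c hc y => by rw [map_smul_eq_mul, Real.norm_of_nonneg hc.le]) (map_add_le_add q) (by
      rintro ⟨x, hx⟩
      obtain ⟨c, rfl⟩ := Submodule.mem_span_singleton.1 hx
      rw [LinearPMap.mkSpanSingleton'_apply, map_smul_eq_mul, smul_eq_mul]
      exact mul_le_mul_of_nonneg_right (le_abs_self c) (apply_nonneg _ _))
  have hLφ : L φ = q φ := by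
    have h1 := hL ⟨φ, Submodule.mem_span_singleton_self φ⟩
    exact h1.trans (LinearPMap.mkSpanSingleton'_apply_self _ _ _ _)
  have habs : ∀ y, |L y| ≤ q y := fun y => abs_le.2
    ⟨by have := hLq (-y); rw [map_neg, map_neg_eq_map] at this; linarith, hLq y⟩
  -- Since |L y| ≤ q y ≤ C‖J y‖, the functional L kills the kernel of J and descends to a bounded
  -- functional on the range; a second application of Hahn-Banach extends it to X.
  obtain ⟨σ, hσ⟩ := J.rangeRestrict.exists_rightInverse_of_surjective J.range_rangeRestrict
  have hJσ : ∀ z : J.range, J (σ z) = z := fun z =>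
    congrArg Subtype.val (LinearMap.congr_fun hσ z)
  obtain ⟨Λ, hΛ, -⟩ := exists_extension_norm_eq J.range
    ((L ∘ₗ σ).mkContinuous C fun z => by
      have := hC (σ z)
      rw [hJσ] at this
      exact (habs _).trans this)
  have hΛL : ∀ y, Λ (J y) = L y := fun y => by
    have h1 := hΛ ⟨J y, LinearMap.mem_range_self J y⟩
    rw [LinearMap.mkContinuous_apply, LinearMap.comp_apply] at h1
    refine h1.trans (sub_eq_zero.1 ?_)
    rw [← map_sub, ← abs_nonpos_iff]
    refine (habs _).trans ((hC _).trans (le_of_eq ?_))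
    rw [map_sub, hJσ, sub_self, norm_zero, mul_zero]
  exact ⟨Λ, (hΛL φ).trans hLφ, fun y => (hΛL y).trans_le (hLq y)⟩

/-- The triangle inequality for a seminorm and a Bochner integral, where the integral is taken in a
Banach space whose norm controls the seminorm. -/
theorem seminorm_le_integral {X Y P : Type*} [AddCommGroup Y] [Module ℂ Y]
    [NormedAddCommGroup X] [NormedSpace ℂ X] [CompleteSpace X] [MeasurableSpace P] {μ : Measure P}
    (J : Y →ₗ[ℂ] X) (q : Seminorm ℂ Y) {C : ℝ} (hC : ∀ y, q y ≤ C * ‖J y‖) {F : P → Y} {φ : Y}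
    (hF : Integrable (fun p => J (F p)) μ) (hφ : J φ = ∫ p, J (F p) ∂μ) {b : P → ℝ}
    (hb : Integrable b μ) (hqb : ∀ p, q (F p) ≤ b p) : q φ ≤ ∫ p, b p ∂μ := by
  obtain ⟨L, hL, hLq⟩ := exists_dual_comp_le_seminorm (J.restrictScalars ℝ)
    (q.restrictScalars ℝ) hC φ
  calc q φ = L (∫ p, J (F p) ∂μ) := by rw [← hφ]; exact hL.symm
    _ = ∫ p, L (J (F p)) ∂μ := (L.integral_comp_comm hF).symm
    _ ≤ ∫ p, b p ∂μ := integral_mono (L.integrable_comp hF) hb fun p => (hLq _).trans (hqb p)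

end SeminormIntegral

/-! ### Weighted convolution estimates. -/

section Decay

variable {d : ℕ}

/-- Weighted estimate for a convolution. -/
theorem mul_integral_norm_mul_norm_le {f h : Rd d → ℂ} {w w' ω : Rd d → ℝ≥0} {K : ℝ}
    (hw : ∀ x y, w (x + y) ≤ w' x * ω y) (hf : ∀ x, ‖f x‖ * w' x ≤ K)
    (hω : Integrable fun x => ‖h x‖ * (ω x : ℝ)) (x : Rd d) :
    (∫ t, ‖f t‖ * ‖h (x - t)‖) * w x ≤ K * ∫ t, ‖h t‖ * (ω t : ℝ) := by
  have h1 : ∀ t, ‖f t‖ * ‖h (x - t)‖ * w x ≤ K * (‖h (x - t)‖ * ω (x - t)) := fun t => by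
    have h2 := hw t (x - t)
    rw [add_sub_cancel] at h2
    have h3 : (w x : ℝ) ≤ w' t * ω (x - t) := by exact_mod_cast h2
    calc ‖f t‖ * ‖h (x - t)‖ * w x ≤ ‖f t‖ * ‖h (x - t)‖ * (w' t * ω (x - t)) := by gcongr
      _ = ‖f t‖ * w' t * (‖h (x - t)‖ * ω (x - t)) := by ring
      _ ≤ _ := by
        have := hf t
        gcongr
  rw [← integral_mul_const, ← integral_const_mul,
    ← integral_sub_left_eq_self (fun t => K * (‖h t‖ * (ω t : ℝ))) volume x]
  exact integral_mono_of_nonneg (Filter.Eventually.of_forall fun t => by positivity)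
    ((hω.const_mul K).comp_sub_left x) (Filter.Eventually.of_forall h1)

/-- From 2uv ≤ u² + v²: it merges a bound in x alone and one in ξ alone into joint decay, at the
price of squared weights. -/
theorem mul_mul_le_of_sq_le {s u v A B : ℝ} (hs : 0 ≤ s) (hu : s * u ^ 2 ≤ A)
    (hv : s * v ^ 2 ≤ B) : s * (u * v) ≤ A + B := by
  nlinarith [mul_nonneg hs (sq_nonneg (u - v)), mul_nonneg hs (sq_nonneg u),
    mul_nonneg hs (sq_nonneg v)]

end Decay

/-! ### Weighted sup norms and bounded continuous functions. -/

section WeightedSpace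

variable {d : ℕ}

theorem norm_mul_le_supNorm {w : Rd d → ℝ≥0} {f : C(Rd d, ℂ)} (hf : f ∈ weightedSpace w)
    (x : Rd d) : ‖f x‖ * (w x : ℝ) ≤ supNorm w f :=
  le_ciSup hf x

theorem supNorm_le {w : Rd d → ℝ≥0} {f : C(Rd d, ℂ)} {K : ℝ} (h : ∀ x, ‖f x‖ * (w x : ℝ) ≤ K) :
    supNorm w f ≤ K :=
  ciSup_le h

theorem supNorm_nonneg (w : Rd d → ℝ≥0) (f : C(Rd d, ℂ)) : 0 ≤ supNorm w f :=
  Real.iSup_nonneg fun x => by positivity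

theorem mem_weightedSpace_of_le {w : Rd d → ℝ≥0} {f : C(Rd d, ℂ)} {K : ℝ}
    (h : ∀ x, ‖f x‖ * (w x : ℝ) ≤ K) : f ∈ weightedSpace w :=
  ⟨K, by rintro _ ⟨x, rfl⟩; exact h x⟩

/-- If `w ≤ C * w'` then `C_{w'} ⊆ C_w`, with the corresponding norm inequality. -/
theorem norm_mul_le_of_le {w w' : Rd d → ℝ≥0} {C : ℝ≥0} (h : ∀ x, w x ≤ C * w' x)
    {f : C(Rd d, ℂ)} (hf : f ∈ weightedSpace w') (x : Rd d) :
    ‖f x‖ * (w x : ℝ) ≤ C * supNorm w' f := by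
  have h1 : (w x : ℝ) ≤ C * w' x := by exact_mod_cast h x
  calc ‖f x‖ * (w x : ℝ) ≤ ‖f x‖ * (C * w' x) := by gcongr
    _ = C * (‖f x‖ * w' x) := by ring
    _ ≤ _ := by
      have := norm_mul_le_supNorm hf x
      gcongr

/-- Multiplication by a continuous weight, as a map from the weighted space to the bounded
continuous functions. -/
noncomputable def weightedToBounded (w : Rd d → ℝ≥0) (hw : Continuous w) :
    weightedSpace w →ₗ[ℂ] BoundedContinuousFunction (Rd d) ℂ where
  toFun f := BoundedContinuousFunction.ofNormedAddCommGroup (fun x => f.1 x * (w x : ℝ))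
    (f.1.continuous.mul (Complex.continuous_ofReal.comp (NNReal.continuous_coe.comp hw)))
    (supNorm w f.1) fun x => by
      simpa using norm_mul_le_supNorm f.2 x
  map_add' f g := by
    ext x
    simp [add_mul]
  map_smul' c f := by
    ext x
    simp [mul_assoc]

theorem weightedToBounded_apply (w : Rd d → ℝ≥0) (hw : Continuous w) (f : weightedSpace w)
    (x : Rd d) : weightedToBounded w hw f x = f.1 x * (w x : ℝ) := rfl

theorem norm_weightedToBounded_apply (w : Rd d → ℝ≥0) (hw : Continuous w) (f : weightedSpace w)
    (x : Rd d) : ‖weightedToBounded w hw f x‖ = ‖f.1 x‖ * (w x : ℝ) := by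
  simp [weightedToBounded_apply]

theorem supNorm_le_norm_weightedToBounded (w : Rd d → ℝ≥0) (hw : Continuous w)
    (f : weightedSpace w) : supNorm w f.1 ≤ ‖weightedToBounded w hw f‖ :=
  supNorm_le fun x => by
    rw [← norm_weightedToBounded_apply w hw]
    exact (weightedToBounded w hw f).norm_coe_le_norm x

/-- Continuity of a map into the bounded continuous functions from joint continuity and locally
uniform smallness at infinity. -/
theorem continuous_boundedContinuousFunction_of_tail {P X : Type*} [TopologicalSpace P]
    [TopologicalSpace X] {F : P → BoundedContinuousFunction X ℂ}
    (hc : Continuous fun q : P × X => F q.1 q.2)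
    (htail : ∀ p₀, ∀ ε > 0, ∃ K : Set X, IsCompact K ∧ ∀ᶠ p in nhds p₀, ∀ t ∉ K, ‖F p t‖ ≤ ε) :
    Continuous F := by
  refine continuous_iff_continuousAt.2 fun p₀ => Metric.tendsto_nhds.2 fun ε hε => ?_
  obtain ⟨K, hK, htail⟩ := htail p₀ (ε / 3) (by positivity)
  have h1 : ∀ᶠ p in nhds p₀, ∀ t ∈ K, dist (F p t) (F p₀ t) < ε / 2 := by
    refine hK.eventually_forall_of_forall_eventually fun t _ => ?_
    have h2 : Continuous fun q : P × X => dist (F q.1 q.2) (F p₀ q.2) :=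
      hc.dist ((F p₀).continuous.comp continuous_snd)
    refine h2.continuousAt.eventually_lt continuousAt_const ?_
    simp only [dist_self]
    positivity
  have h3 := htail.self_of_nhds
  filter_upwards [h1, htail] with p hp1 hp2
  refine lt_of_le_of_lt ((BoundedContinuousFunction.dist_le (C := 2 * ε / 3) (by positivity)).2
    fun t => ?_) (by linarith : 2 * ε / 3 < ε)
  by_cases ht : t ∈ K
  · exact (hp1 t ht).le.trans (by linarith)
  · rw [dist_eq_norm]
    refine (norm_sub_le _ _).trans ?_
    linarith [hp2 t ht, h3 t ht]

end WeightedSpace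

/-! ### The spaces S^v_w and their embedding into a Banach space. -/

section BBSpace

variable {d : ℕ}

theorem represents_density_of_mem {v w : Rd d → ℝ≥0} {T : 𝓢'(Rd d, ℂ)} (hT : T ∈ bbSubmodule v w) :
    Represents (density T) T := by
  obtain ⟨⟨f, -, hfT⟩, -⟩ := hT
  rwa [hfT.density_eq]

theorem represents_density_fourier_of_mem {v w : Rd d → ℝ≥0} {T : 𝓢'(Rd d, ℂ)}
    (hT : T ∈ bbSubmodule v w) : Represents (density (𝓕 T)) (𝓕 T) := by
  obtain ⟨-, g, -, hgT⟩ := hT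
  rwa [hgT.density_eq]

theorem density_mem_weightedSpace {v w : Rd d → ℝ≥0} {T : 𝓢'(Rd d, ℂ)} (hT : T ∈ bbSubmodule v w) :
    density T ∈ weightedSpace w := by
  obtain ⟨⟨f, hf, hfT⟩, -⟩ := hT
  rwa [hfT.density_eq]

theorem density_fourier_mem_weightedSpace {v w : Rd d → ℝ≥0} {T : 𝓢'(Rd d, ℂ)}
    (hT : T ∈ bbSubmodule v w) : density (𝓕 T) ∈ weightedSpace v := by
  obtain ⟨-, g, hg, hgT⟩ := hT
  rwa [hgT.density_eq]

theorem mem_bbSubmodule_of_represents {v w : Rd d → ℝ≥0} {T : 𝓢'(Rd d, ℂ)}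
    (h : Represents (density T) T) (h' : Represents (density (𝓕 T)) (𝓕 T))
    (hw : density T ∈ weightedSpace w) (hv : density (𝓕 T) ∈ weightedSpace v) :
    T ∈ bbSubmodule v w :=
  ⟨⟨_, hw, h⟩, _, hv, h'⟩

theorem density_fourier_add_of_mem {v w : Rd d → ℝ≥0} {T U : 𝓢'(Rd d, ℂ)}
    (hT : T ∈ bbSubmodule v w) (hU : U ∈ bbSubmodule v w) :
    density (𝓕 (T + U)) = density (𝓕 T) + density (𝓕 U) := by
  rw [FourierTransform.fourier_add]
  exact ((represents_density_fourier_of_mem hT).add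
    (represents_density_fourier_of_mem hU)).density_eq

theorem density_fourier_smul_of_mem {v w : Rd d → ℝ≥0} {T : 𝓢'(Rd d, ℂ)} (c : ℂ)
    (hT : T ∈ bbSubmodule v w) : density (𝓕 (c • T)) = c • density (𝓕 T) := by
  rw [FourierTransform.fourier_smul]
  exact ((represents_density_fourier_of_mem hT).smul c).density_eq

/-- The tempered distribution underlying an element of `S^v_w`. -/
noncomputable def BBSpace.toDistribution (v w : Rd d → ℝ≥0) : BBSpace v w →ₗ[ℂ] 𝓢'(Rd d, ℂ) :=
  (bbSubmodule v w).subtype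

theorem BBSpace.toDistribution_mem {v w : Rd d → ℝ≥0} (y : BBSpace v w) :
    BBSpace.toDistribution v w y ∈ bbSubmodule v w :=
  y.2

/-- An element of `S^v_w` from a tempered distribution. -/
def BBSpace.mk {v w : Rd d → ℝ≥0} (T : 𝓢'(Rd d, ℂ)) (hT : T ∈ bbSubmodule v w) : BBSpace v w :=
  ⟨T, hT⟩

theorem BBSpace.toDistribution_mk {v w : Rd d → ℝ≥0} (T : 𝓢'(Rd d, ℂ)) (hT : T ∈ bbSubmodule v w) :
    BBSpace.toDistribution v w (BBSpace.mk T hT) = T := rfl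

theorem BBSpace.norm_eq {v w : Rd d → ℝ≥0} (y : BBSpace v w) :
    ‖y‖ = supNorm w (density (BBSpace.toDistribution v w y)) +
      supNorm v (density (𝓕 (BBSpace.toDistribution v w y))) := rfl

noncomputable instance (v w : Rd d → ℝ≥0) : NormedSpace ℂ (BBSpace v w) where
  __ := (inferInstance : Module ℂ (BBSpace v w))
  norm_smul_le c y := (map_smul_eq_mul (bbSeminorm v w) c y).le

/-- The continuous function underlying an element of `S^v_w`. -/
noncomputable def BBSpace.densityMap (v w : Rd d → ℝ≥0) :
    BBSpace v w →ₗ[ℂ] weightedSpace w where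
  toFun y := ⟨density (BBSpace.toDistribution v w y), density_mem_weightedSpace y.toDistribution_mem⟩
  map_add' y z := Subtype.ext ((represents_density_of_mem y.toDistribution_mem).add
    (represents_density_of_mem z.toDistribution_mem)).density_eq
  map_smul' c y := Subtype.ext
    ((represents_density_of_mem y.toDistribution_mem).smul c).density_eq

/-- The Fourier transform of an element of `S^v_w`, as a continuous function. -/
noncomputable def BBSpace.fourierDensityMap (v w : Rd d → ℝ≥0) :
    BBSpace v w →ₗ[ℂ] weightedSpace v where
  toFun y := ⟨density (𝓕 (BBSpace.toDistribution v w y)),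
    density_fourier_mem_weightedSpace y.toDistribution_mem⟩
  map_add' y z := Subtype.ext (density_fourier_add_of_mem y.toDistribution_mem z.toDistribution_mem)
  map_smul' c y := Subtype.ext (density_fourier_smul_of_mem c y.toDistribution_mem)

/-- The embedding `φ ↦ (φ w, φ̂ v)` of `S^v_w` into a Banach space, for continuous weights. -/
noncomputable def BBSpace.toBounded {v w : Rd d → ℝ≥0} (hv : Continuous v) (hw : Continuous w) :
    BBSpace v w →ₗ[ℂ]
      BoundedContinuousFunction (Rd d) ℂ × BoundedContinuousFunction (Rd d) ℂ :=
  (weightedToBounded w hw ∘ₗ BBSpace.densityMap v w).prod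
    (weightedToBounded v hv ∘ₗ BBSpace.fourierDensityMap v w)

theorem BBSpace.toBounded_fst_apply {v w : Rd d → ℝ≥0} (hv : Continuous v) (hw : Continuous w)
    (y : BBSpace v w) (t : Rd d) :
    (BBSpace.toBounded hv hw y).1 t = density (BBSpace.toDistribution v w y) t * (w t : ℝ) := rfl

theorem BBSpace.toBounded_snd_apply {v w : Rd d → ℝ≥0} (hv : Continuous v) (hw : Continuous w)
    (y : BBSpace v w) (t : Rd d) : (BBSpace.toBounded hv hw y).2 t =
      density (𝓕 (BBSpace.toDistribution v w y)) t * (v t : ℝ) := rfl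

/-- The factor 2 compares the sum of two suprema with the maximum norm of the product. -/
theorem BBSpace.norm_le_toBounded {v w : Rd d → ℝ≥0} (hv : Continuous v) (hw : Continuous w)
    (y : BBSpace v w) : ‖y‖ ≤ 2 * ‖BBSpace.toBounded hv hw y‖ := by
  have h1 : supNorm w (density (BBSpace.toDistribution v w y)) ≤ ‖BBSpace.toBounded hv hw y‖ :=
    (supNorm_le_norm_weightedToBounded w hw (BBSpace.densityMap v w y)).trans (norm_fst_le (BBSpace.toBounded hv hw y))
  have h2 : supNorm v (density (𝓕 (BBSpace.toDistribution v w y))) ≤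
      ‖BBSpace.toBounded hv hw y‖ :=
    (supNorm_le_norm_weightedToBounded v hv (BBSpace.fourierDensityMap v w y)).trans
      (norm_snd_le (BBSpace.toBounded hv hw y))
  rw [BBSpace.norm_eq]
  linarith

theorem BBSpace.norm_toBounded_le {v w : Rd d → ℝ≥0} (hv : Continuous v) (hw : Continuous w)
    (y : BBSpace v w) : ‖BBSpace.toBounded hv hw y‖ ≤ ‖y‖ := by
  have h1 := supNorm_nonneg w (density (BBSpace.toDistribution v w y))
  have h2 := supNorm_nonneg v (density (𝓕 (BBSpace.toDistribution v w y)))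
  rw [BBSpace.norm_eq]
  refine max_le ?_ ?_
  · refine (BoundedContinuousFunction.norm_le (by positivity)).2 fun t => ?_
    rw [BBSpace.toBounded_fst_apply, norm_mul, Complex.norm_real, Real.norm_of_nonneg (by positivity)]
    linarith [norm_mul_le_supNorm (density_mem_weightedSpace y.toDistribution_mem) t]
  · refine (BoundedContinuousFunction.norm_le (by positivity)).2 fun t => ?_
    rw [BBSpace.toBounded_snd_apply, norm_mul, Complex.norm_real, Real.norm_of_nonneg (by positivity)]
    linarith [norm_mul_le_supNorm (density_fourier_mem_weightedSpace y.toDistribution_mem) t]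

theorem integrable_of_mem_weightedSpace {W : WeightFunctionSystem d} (hN : W.RoumieuN)
    {l : Set.Ioi (0 : ℝ)} {f : C(Rd d, ℂ)} (hf : f ∈ weightedSpace (W.weight l)) :
    Integrable f := by
  refine ((hN.integrable_inv_weight l).const_mul (supNorm (W.weight l) f)).mono'
    f.continuous.aestronglyMeasurable (Filter.Eventually.of_forall fun x => ?_)
  have h1 : (0 : ℝ) < W.weight l x := by exact_mod_cast W.weight_pos l x
  rw [← div_eq_mul_inv, le_div_iff₀ h1]
  exact norm_mul_le_supNorm hf x

/-- {N} makes w^n/w^l integrable for some n. This provides the weighted L¹ windows required by the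
convolution estimates. -/
theorem exists_integrable_norm_mul_weight {W : WeightFunctionSystem d} (hN : W.RoumieuN)
    {l : Set.Ioi (0 : ℝ)} {f : C(Rd d, ℂ)} (hf : f ∈ weightedSpace (W.weight l)) :
    ∃ n, Integrable fun x => ‖f x‖ * (W.weight n x : ℝ) := by
  obtain ⟨n, hn⟩ := hN l
  refine ⟨n, (hn.const_mul (supNorm (W.weight l) f)).mono' (f.continuous.norm.mul
    (NNReal.continuous_coe.comp (W.continuous_weight n))).aestronglyMeasurable
    (Filter.Eventually.of_forall fun x => ?_)⟩
  have h1 : (0 : ℝ) < W.weight l x := by exact_mod_cast W.weight_pos l x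
  rw [Real.norm_of_nonneg (by positivity), ← mul_div_assoc, le_div_iff₀ h1, mul_right_comm]
  have := norm_mul_le_supNorm hf x
  gcongr

theorem fourier_density {V W : WeightFunctionSystem d} (hWN : W.RoumieuN)
    {l : Set.Ioi (0 : ℝ)} {T : 𝓢'(Rd d, ℂ)}
    (hT : T ∈ bbSubmodule (V.weight l) (W.weight l)) :
    𝓕 (density T : Rd d → ℂ) = density (𝓕 T) :=
  (represents_density_of_mem hT).fourier_eq (represents_density_fourier_of_mem hT)
    (integrable_of_mem_weightedSpace hWN (density_mem_weightedSpace hT))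

theorem fourierIntegrable_density {V W : WeightFunctionSystem d} (hVN : V.RoumieuN)
    (hWN : W.RoumieuN) {l : Set.Ioi (0 : ℝ)} {T : 𝓢'(Rd d, ℂ)}
    (hT : T ∈ bbSubmodule (V.weight l) (W.weight l)) : FourierIntegrable (density T) where
  continuous := (density T).continuous
  integrable := integrable_of_mem_weightedSpace hWN (density_mem_weightedSpace hT)
  integrable_fourier := by
    rw [fourier_density hWN hT]
    exact integrable_of_mem_weightedSpace hVN (density_fourier_mem_weightedSpace hT)

end BBSpace

/-! ### Time-frequency shifts: growth and continuity in the shift. -/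

section Atoms

variable {d : ℕ} {V W : WeightFunctionSystem d}

/-- Translates of functions in a step are, in a later step, bounded by the translated weight. -/
theorem exists_norm_comp_sub_mul_weight_le (hM : W.RoumieuM) {n : Set.Ioi (0 : ℝ)}
    {h : C(Rd d, ℂ)} (hh : h ∈ weightedSpace (W.weight n)) (m : Set.Ioi (0 : ℝ)) :
    ∃ l₀, ∀ l, l₀ ≤ l → ∃ K : ℝ, 0 ≤ K ∧
      ∀ x t, ‖h (t - x)‖ * (W.weight l t : ℝ) ≤ K * W.weight m x := by
  obtain ⟨l₀, C, -, hC⟩ := hM m n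
  refine ⟨l₀, fun l hl => ⟨C * supNorm (W.weight n) h,
    mul_nonneg C.coe_nonneg (supNorm_nonneg _ _), fun x t => ?_⟩⟩
  have h1 := (W.weight_le_weight _ _ hl t).trans
    (le_of_eq_of_le (by rw [add_sub_cancel]) (hC x (t - x)))
  have h2 : (W.weight l t : ℝ) ≤ C * W.weight m x * W.weight n (t - x) := by exact_mod_cast h1
  calc ‖h (t - x)‖ * (W.weight l t : ℝ) ≤
        ‖h (t - x)‖ * (C * W.weight m x * W.weight n (t - x)) := by gcongr
    _ = C * W.weight m x * (‖h (t - x)‖ * W.weight n (t - x)) := by ring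
    _ ≤ C * W.weight m x * supNorm (W.weight n) h := by
        have := norm_mul_le_supNorm hh (t - x)
        gcongr
    _ = _ := by ring

/-- Translates of functions in a step are, in a later step, locally uniformly small at infinity. -/
theorem exists_norm_comp_sub_mul_weight_tail (hM : W.RoumieuM) (hSq : W.RoumieuSq)
    (hN : W.RoumieuN) {n : Set.Ioi (0 : ℝ)} {h : C(Rd d, ℂ)} (hh : h ∈ weightedSpace (W.weight n)) :
    ∃ l₀, ∀ l, l₀ ≤ l → ∀ x₀, ∀ ε > 0, ∃ K : Set (Rd d), IsCompact K ∧
      ∀ᶠ x in nhds x₀, ∀ t ∉ K, ‖h (t - x)‖ * (W.weight l t : ℝ) ≤ ε := by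
  -- {Sq} provides two factors w^k(t - x): one is used up by {M}, and the inverse of the other gives
  -- smallness at infinity.
  obtain ⟨k, D, hD⟩ := hSq.exists_sq_le n
  obtain ⟨l₀, C, -, hC⟩ := hM k k
  refine ⟨l₀, fun l hl x₀ ε hε => ?_⟩
  set A : ℝ := C * (W.weight k x₀ + 1) * (D * supNorm (W.weight n) h) with hA
  have hs := supNorm_nonneg (W.weight n) h
  have hA0 : 0 ≤ A := by positivity
  have htend := WeightFunctionSystem.tendsto_inv_weight hM hN k
  have hev : ∀ᶠ y in Filter.cocompact (Rd d), ((W.weight k y)⁻¹ : ℝ) < ε / (A + 1) :=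
    htend.eventually_lt_const (by positivity)
  obtain ⟨K₀, hK₀, hK₀s⟩ := Filter.mem_cocompact.1 hev
  -- If t lies outside K₀ plus the unit ball around x₀, then t - x avoids K₀ for all x in that ball
  -- at once.
  refine ⟨(fun q : Rd d × Rd d => q.1 + q.2) '' (K₀ ×ˢ Metric.closedBall x₀ 1),
    (hK₀.prod (isCompact_closedBall _ _)).image continuous_add, ?_⟩
  have h1 : ∀ᶠ x in nhds x₀, W.weight k x < W.weight k x₀ + 1 :=
    (W.continuous_weight k).continuousAt.eventually_lt_const (lt_add_one _)
  filter_upwards [h1, Metric.closedBall_mem_nhds x₀ one_pos] with x hx hx' t ht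
  have hty : t - x ∉ K₀ := fun hmem => ht ⟨(t - x, x), ⟨hmem, hx'⟩, sub_add_cancel t x⟩
  have h2 : ((W.weight k (t - x))⁻¹ : ℝ) < ε / (A + 1) := hK₀s hty
  have h3 := (W.weight_le_weight _ _ hl t).trans
    (le_of_eq_of_le (by rw [add_sub_cancel]) (hC x (t - x)))
  have h4 : (W.weight l t : ℝ) ≤ C * W.weight k x * W.weight k (t - x) := by exact_mod_cast h3
  have h5 : ‖h (t - x)‖ * (W.weight k (t - x) : ℝ) ^ 2 ≤ D * supNorm (W.weight n) h := by
    have := norm_mul_le_of_le hD hh (t - x)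
    exact_mod_cast this
  have h6 : (0 : ℝ) < W.weight k (t - x) := by exact_mod_cast W.weight_pos k (t - x)
  have h7 : (W.weight k x : ℝ) ≤ W.weight k x₀ + 1 := by exact_mod_cast hx.le
  calc ‖h (t - x)‖ * (W.weight l t : ℝ) ≤
        ‖h (t - x)‖ * (C * W.weight k x * W.weight k (t - x)) := by gcongr
    _ = C * W.weight k x * (‖h (t - x)‖ * (W.weight k (t - x) : ℝ) ^ 2) *
          (W.weight k (t - x) : ℝ)⁻¹ := by field_simp
    _ ≤ A * (ε / (A + 1)) := by
        rw [hA]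
        gcongr
    _ ≤ ε := by
        rw [mul_div_left_comm]
        exact mul_le_of_le_one_right hε.le ((div_le_one (by positivity)).2 (by linarith))

/-- The time-frequency shift of an integrable function as a tempered distribution. -/
noncomputable def atomDistribution {γ : Rd d → ℂ} (hγ : FourierIntegrable γ) (x ξ : Rd d) :
    𝓢'(Rd d, ℂ) :=
  ofIntegrable (atom γ x ξ) (hγ.atom_right x ξ).integrable

theorem density_atomDistribution {γ : Rd d → ℂ} (hγ : FourierIntegrable γ) (x ξ : Rd d) :
    density (atomDistribution hγ x ξ) = ⟨atom γ x ξ, (hγ.atom_right x ξ).continuous⟩ :=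
  (represents_ofIntegrable ⟨atom γ x ξ, (hγ.atom_right x ξ).continuous⟩
    (hγ.atom_right x ξ).integrable).density_eq

theorem density_fourier_atomDistribution {γ : Rd d → ℂ} (hγ : FourierIntegrable γ) (x ξ : Rd d) :
    density (𝓕 (atomDistribution hγ x ξ)) =
      ⟨𝓕 (atom γ x ξ), (hγ.atom_right x ξ).continuous_fourier⟩ :=
  (represents_fourier_ofIntegrable (hγ.atom_right x ξ).integrable).density_eq

theorem atomDistribution_mem {γ : Rd d → ℂ} (hγ : FourierIntegrable γ) {x ξ : Rd d}
    {v w : Rd d → ℝ≥0} {A B : ℝ} (hA : ∀ t, ‖γ (t - x)‖ * (w t : ℝ) ≤ A)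
    (hB : ∀ η, ‖𝓕 γ (η - ξ)‖ * (v η : ℝ) ≤ B) : atomDistribution hγ x ξ ∈ bbSubmodule v w := by
  refine ⟨⟨⟨atom γ x ξ, (hγ.atom_right x ξ).continuous⟩, mem_weightedSpace_of_le (K := A) fun t => ?_,
    represents_ofIntegrable _ _⟩, _, mem_weightedSpace_of_le (K := B) fun η => ?_,
    represents_fourier_ofIntegrable (hγ.atom_right x ξ).integrable⟩
  · exact (norm_atom (γ := γ) x ξ t).symm ▸ hA t
  · exact (norm_fourier_atom (γ := γ) x ξ η).symm ▸ hB η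

theorem norm_mk_atomDistribution_le {γ : Rd d → ℂ} (hγ : FourierIntegrable γ) {x ξ : Rd d}
    {v w : Rd d → ℝ≥0} {A B : ℝ} (hA : ∀ t, ‖γ (t - x)‖ * (w t : ℝ) ≤ A)
    (hB : ∀ η, ‖𝓕 γ (η - ξ)‖ * (v η : ℝ) ≤ B) (hmem : atomDistribution hγ x ξ ∈ bbSubmodule v w) :
    ‖BBSpace.mk _ hmem‖ ≤ A + B := by
  rw [BBSpace.norm_eq, BBSpace.toDistribution_mk, density_atomDistribution,
    density_fourier_atomDistribution]
  refine add_le_add (supNorm_le fun t => ?_) (supNorm_le fun η => ?_)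
  · exact (norm_atom (γ := γ) x ξ t).symm ▸ hA t
  · exact (norm_fourier_atom (γ := γ) x ξ η).symm ▸ hB η

/-- Time-frequency shifts of an element of the Roumieu space: membership in a step with the
corresponding norm bound. -/
theorem exists_atomDistribution_mem (hVM : V.RoumieuM) (hWM : W.RoumieuM)
    {n : Set.Ioi (0 : ℝ)} {γ γ' : C(Rd d, ℂ)} (hγ : FourierIntegrable γ)
    (hγ' : 𝓕 (γ : Rd d → ℂ) = γ') (hγw : γ ∈ weightedSpace (W.weight n))
    (hγv : γ' ∈ weightedSpace (V.weight n)) (m : Set.Ioi (0 : ℝ)) :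
    ∃ l₀, ∀ l, l₀ ≤ l → ∃ K : ℝ, 0 ≤ K ∧ ∀ x ξ,
      ∃ hmem : atomDistribution hγ x ξ ∈ bbSubmodule (V.weight l) (W.weight l),
        ‖BBSpace.mk _ hmem‖ ≤ K * W.weight m x * V.weight m ξ := by
  obtain ⟨l₁, h₁⟩ := exists_norm_comp_sub_mul_weight_le hWM hγw m
  obtain ⟨l₂, h₂⟩ := exists_norm_comp_sub_mul_weight_le hVM hγv m
  refine ⟨max l₁ l₂, fun l hl => ?_⟩
  obtain ⟨A, hA0, hA⟩ := h₁ l ((le_max_left _ _).trans hl)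
  obtain ⟨B, hB0, hB⟩ := h₂ l ((le_max_right _ _).trans hl)
  rw [← hγ'] at hB
  refine ⟨A + B, by positivity, fun x ξ =>
    ⟨atomDistribution_mem hγ (hA x) (hB ξ), (norm_mk_atomDistribution_le hγ (hA x) (hB ξ) _).trans ?_⟩⟩
  have h3 : (1 : ℝ) ≤ W.weight m x := by exact_mod_cast W.one_le_weight m x
  have h4 : (1 : ℝ) ≤ V.weight m ξ := by exact_mod_cast V.one_le_weight m ξ
  have h5 : A * W.weight m x ≤ A * W.weight m x * V.weight m ξ :=
    le_mul_of_one_le_right (by positivity) h4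
  have h6 : B * V.weight m ξ ≤ B * V.weight m ξ * W.weight m x :=
    le_mul_of_one_le_right (by positivity) h3
  nlinarith

/-- Time-frequency shifts depend continuously on the shift in the norm of a step. -/
theorem exists_continuous_toBounded_atom (hVM : V.RoumieuM) (hVSq : V.RoumieuSq)
    (hVN : V.RoumieuN) (hWM : W.RoumieuM) (hWSq : W.RoumieuSq) (hWN : W.RoumieuN)
    {n : Set.Ioi (0 : ℝ)} {γ γ' : C(Rd d, ℂ)} (hγ : FourierIntegrable γ)
    (hγ' : 𝓕 (γ : Rd d → ℂ) = γ') (hγw : γ ∈ weightedSpace (W.weight n))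
    (hγv : γ' ∈ weightedSpace (V.weight n)) :
    ∃ l₀, ∀ l, l₀ ≤ l →
      ∀ hmem : ∀ x ξ, atomDistribution hγ x ξ ∈ bbSubmodule (V.weight l) (W.weight l),
      Continuous fun p : Rd d × Rd d =>
        BBSpace.toBounded (V.continuous_weight l) (W.continuous_weight l)
          (BBSpace.mk _ (hmem p.1 p.2)) := by
  obtain ⟨l₁, h₁⟩ := exists_norm_comp_sub_mul_weight_tail hWM hWSq hWN hγw
  obtain ⟨l₂, h₂⟩ := exists_norm_comp_sub_mul_weight_tail hVM hVSq hVN hγv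
  rw [← hγ'] at h₂
  refine ⟨max l₁ l₂, fun l hl hmem => ?_⟩
  let J : Rd d × Rd d → _ := fun p => BBSpace.toBounded (V.continuous_weight l)
    (W.continuous_weight l) (BBSpace.mk _ (hmem p.1 p.2))
  refine (?_ : Continuous fun p => (J p).1).prodMk (?_ : Continuous fun p => (J p).2)
  · have hval : ∀ (p : Rd d × Rd d) t,
        (J p).1 t = atom γ p.1 p.2 t * (W.weight l t : ℝ) :=
      fun p t => by
        rw [BBSpace.toBounded_fst_apply (V.continuous_weight l) (W.continuous_weight l), BBSpace.toDistribution_mk, density_atomDistribution]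
        rfl
    refine continuous_boundedContinuousFunction_of_tail ?_ fun p₀ ε hε => ?_
    · simp only [hval]
      exact (continuous_atom γ.continuous).mul (Complex.continuous_ofReal.comp
        (NNReal.continuous_coe.comp ((W.continuous_weight l).comp continuous_snd)))
    · obtain ⟨K, hK, hev⟩ := h₁ l ((le_max_left _ _).trans hl) p₀.1 ε hε
      refine ⟨K, hK, ?_⟩
      filter_upwards [continuous_fst.continuousAt.eventually hev] with p hp t ht
      rw [hval, norm_mul, norm_atom, Complex.norm_real, Real.norm_of_nonneg (by positivity)]
      exact hp t ht
  · have hval : ∀ (p : Rd d × Rd d) t,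
        (J p).2 t = 𝓕 (atom γ p.1 p.2) t * (V.weight l t : ℝ) :=
      fun p t => by
        rw [BBSpace.toBounded_snd_apply, BBSpace.toDistribution_mk,
          density_fourier_atomDistribution]
        rfl
    refine continuous_boundedContinuousFunction_of_tail ?_ fun p₀ ε hε => ?_
    · simp only [hval]
      exact (continuous_fourier_atom hγ.continuous_fourier).mul (Complex.continuous_ofReal.comp
        (NNReal.continuous_coe.comp ((V.continuous_weight l).comp continuous_snd)))
    · obtain ⟨K, hK, hev⟩ := h₂ l ((le_max_right _ _).trans hl) p₀.2 ε hε
      refine ⟨K, hK, ?_⟩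
      filter_upwards [continuous_snd.continuousAt.eventually hev] with p hp t ht
      rw [hval, norm_mul, norm_fourier_atom, Complex.norm_real,
        Real.norm_of_nonneg (by positivity)]
      exact hp t ht

end Atoms

/-! ### Joint decay of the short-time Fourier transform. -/

section ShortTimeDecay

variable {d : ℕ}

/-- Decay of the short-time Fourier transform. -/
theorem norm_stft_mul_mul_le {f θ : Rd d → ℂ} (hf : FourierIntegrable f) (hθ : FourierIntegrable θ)
    {u u' ω v v' ω' : Rd d → ℝ≥0} (hu : ∀ x y, u (x + y) * u (x + y) ≤ u' x * ω y)
    (hv : ∀ x y, v (x + y) * v (x + y) ≤ v' x * ω' y)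
    (hω : Integrable fun x => ‖θ x‖ * (ω x : ℝ))
    (hω' : Integrable fun x => ‖𝓕 θ x‖ * (ω' x : ℝ)) {A B : ℝ}
    (hA : ∀ x, ‖f x‖ * (u' x : ℝ) ≤ A) (hB : ∀ x, ‖𝓕 f x‖ * (v' x : ℝ) ≤ B) (x ξ : Rd d) :
    ‖stft f θ x ξ‖ * (u x * v ξ : ℝ) ≤
      A * (∫ t, ‖θ t‖ * (ω t : ℝ)) + B * ∫ t, ‖𝓕 θ t‖ * (ω' t : ℝ) := by
  refine mul_mul_le_of_sq_le (norm_nonneg _) ?_ ?_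
  · have h1 := mul_integral_norm_mul_norm_le (w := fun x => u x * u x) hu hA hω x
    rw [NNReal.coe_mul, ← sq] at h1
    exact (mul_le_mul_of_nonneg_right (norm_stft_le x ξ) (by positivity)).trans h1
  · have h1 := mul_integral_norm_mul_norm_le (w := fun x => v x * v x) hv hB hω' ξ
    rw [NNReal.coe_mul, ← sq] at h1
    exact (mul_le_mul_of_nonneg_right (norm_stft_le_fourier hf hθ x ξ) (by positivity)).trans h1

end ShortTimeDecay

/-! ### The reproducing formula in a step. -/

section Reproducing

variable {d : ℕ} {V W : WeightFunctionSystem d}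

/-- The reproducing formula for the short-time Fourier transform, as a Bochner integral. -/
theorem toBounded_eq_integral {v w : Rd d → ℝ≥0} (hv : Continuous v) (hw : Continuous w)
    {γ θ : Rd d → ℂ} (hγ : FourierIntegrable γ) (hθ : FourierIntegrable θ)
    (hc : windowPairing θ γ ≠ 0) {T : 𝓢'(Rd d, ℂ)} (hT : T ∈ bbSubmodule v w)
    (hf : FourierIntegrable (density T)) (hf' : 𝓕 (density T : Rd d → ℂ) = density (𝓕 T))
    (hmem : ∀ x ξ, atomDistribution hγ x ξ ∈ bbSubmodule v w)
    (hS : Integrable (fun p : Rd d × Rd d => stft (density T) θ p.1 p.2) volume)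
    (hF : Integrable (fun p : Rd d × Rd d => BBSpace.toBounded hv hw
      (((windowPairing θ γ)⁻¹ * stft (density T) θ p.1 p.2) • BBSpace.mk _ (hmem p.1 p.2))) volume) :
    BBSpace.toBounded hv hw (BBSpace.mk T hT) = ∫ p : Rd d × Rd d, BBSpace.toBounded hv hw
      (((windowPairing θ γ)⁻¹ * stft (density T) θ p.1 p.2) • BBSpace.mk _ (hmem p.1 p.2)) := by
  -- Point evaluations are continuous and separate points, so the vector identity reduces to the two
  -- scalar inversion formulas, for φ and for φ̂.
  let E : Rd d → BoundedContinuousFunction (Rd d) ℂ →L[ℂ] ℂ := fun t =>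
    BoundedContinuousFunction.evalCLM ℂ t
  refine Prod.ext (BoundedContinuousFunction.ext fun t => ?_)
    (BoundedContinuousFunction.ext fun t => ?_)
  · have h1 := (((E t).comp (ContinuousLinearMap.fst ℂ _ _)).integral_comp_comm hF).symm
    refine Eq.trans ?_ h1.symm
    have h2 : ∀ p : Rd d × Rd d, ((E t).comp (ContinuousLinearMap.fst ℂ _ _))
        (BBSpace.toBounded hv hw (((windowPairing θ γ)⁻¹ * stft (density T) θ p.1 p.2) •
          BBSpace.mk _ (hmem p.1 p.2))) = stft (density T) θ p.1 p.2 * atom γ p.1 p.2 t *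
            ((windowPairing θ γ)⁻¹ * (w t : ℝ)) := fun p => by
      rw [map_smul, map_smul, smul_eq_mul]
      change _ * (BBSpace.toBounded hv hw (BBSpace.mk _ (hmem p.1 p.2))).1 t = _
      rw [BBSpace.toBounded_fst_apply hv hw, BBSpace.toDistribution_mk, density_atomDistribution]
      change _ * (atom γ p.1 p.2 t * _) = _
      ring
    simp_rw [h2]
    rw [integral_mul_const, integral_stft_mul_atom hf hθ hγ hS, BBSpace.toBounded_fst_apply hv hw,
      BBSpace.toDistribution_mk]
    field_simp
  · have h1 := (((E t).comp (ContinuousLinearMap.snd ℂ _ _)).integral_comp_comm hF).symm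
    refine Eq.trans ?_ h1.symm
    have h2 : ∀ p : Rd d × Rd d, ((E t).comp (ContinuousLinearMap.snd ℂ _ _))
        (BBSpace.toBounded hv hw (((windowPairing θ γ)⁻¹ * stft (density T) θ p.1 p.2) •
          BBSpace.mk _ (hmem p.1 p.2))) = stft (density T) θ p.1 p.2 * 𝓕 (atom γ p.1 p.2) t *
            ((windowPairing θ γ)⁻¹ * (v t : ℝ)) := fun p => by
      rw [map_smul, map_smul, smul_eq_mul]
      change _ * (BBSpace.toBounded hv hw (BBSpace.mk _ (hmem p.1 p.2))).2 t = _
      rw [BBSpace.toBounded_snd_apply hv hw, BBSpace.toDistribution_mk,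
        density_fourier_atomDistribution]
      change _ * (𝓕 (atom γ p.1 p.2) t * _) = _
      ring
    simp_rw [h2]
    rw [integral_mul_const, integral_stft_mul_fourier_atom hf hθ hγ hS,
      BBSpace.toBounded_snd_apply hv hw, BBSpace.toDistribution_mk, hf']
    field_simp

/-- {Sq} is applied twice before {M}. The joint decay estimate squares its weights, and those are
already squares (w^m)²: one factor w^m offsets the growth of the shifts, the other secures
integrability. -/
theorem WeightFunctionSystem.exists_pow_four_le (hM : W.RoumieuM) (hSq : W.RoumieuSq)
    (l n : Set.Ioi (0 : ℝ)) : ∃ m₀, ∀ m, m₀ ≤ m → ∃ C : ℝ≥0, ∀ x y,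
      W.weight m (x + y) * W.weight m (x + y) * (W.weight m (x + y) * W.weight m (x + y)) ≤
        C * W.weight l x * W.weight n y := by
  obtain ⟨k, A, -, hA⟩ := hM l n
  obtain ⟨j, B, hB⟩ := hSq.exists_sq_le k
  obtain ⟨m₀, C, hC⟩ := hSq.exists_sq_le j
  refine ⟨m₀, fun m hm => ⟨C ^ 2 * B * A, fun x y => ?_⟩⟩
  have h1 := W.weight_le_weight _ _ hm (x + y)
  calc _ ≤ W.weight m₀ (x + y) * W.weight m₀ (x + y) *
        (W.weight m₀ (x + y) * W.weight m₀ (x + y)) := by gcongr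
    _ = (W.weight m₀ (x + y) ^ 2) ^ 2 := by ring
    _ ≤ (C * W.weight j (x + y)) ^ 2 := by
        have := hC (x + y)
        gcongr
    _ = C ^ 2 * W.weight j (x + y) ^ 2 := by ring
    _ ≤ C ^ 2 * (B * (A * W.weight l x * W.weight n y)) := by
        have := (hB (x + y)).trans (mul_le_mul_right (hA x y) B)
        gcongr
    _ = _ := by ring

/-- The short-time Fourier transform of an element of a step decays faster than the inverse of a
product of weights with large index. -/
theorem exists_norm_stft_le_inv_weight (hVM : V.RoumieuM) (hVSq : V.RoumieuSq)
    (hWM : W.RoumieuM) (hWSq : W.RoumieuSq) {θ : Rd d → ℂ} (hθ : FourierIntegrable θ)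
    {n n' : Set.Ioi (0 : ℝ)} (hω : Integrable fun x => ‖θ x‖ * (W.weight n x : ℝ))
    (hω' : Integrable fun x => ‖𝓕 θ x‖ * (V.weight n' x : ℝ)) {f g : C(Rd d, ℂ)}
    (hf : FourierIntegrable f) (hfg : 𝓕 (f : Rd d → ℂ) = g) {l : Set.Ioi (0 : ℝ)}
    (hfw : f ∈ weightedSpace (W.weight l)) (hgv : g ∈ weightedSpace (V.weight l)) :
    ∃ m, ∃ D : ℝ, ∀ x ξ, ‖stft f θ x ξ‖ * (W.weight m x * V.weight m ξ : ℝ) ≤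
      D * ((W.weight m x : ℝ)⁻¹ * (V.weight m ξ : ℝ)⁻¹) := by
  obtain ⟨m₁, h₁⟩ := WeightFunctionSystem.exists_pow_four_le hWM hWSq l n
  obtain ⟨m₂, h₂⟩ := WeightFunctionSystem.exists_pow_four_le hVM hVSq l n'
  obtain ⟨A, hA⟩ := h₁ (max m₁ m₂) (le_max_left _ _)
  obtain ⟨B, hB⟩ := h₂ (max m₁ m₂) (le_max_right _ _)
  set m := max m₁ m₂
  have h3 := norm_stft_mul_mul_le hf hθ (u := fun x => W.weight m x * W.weight m x)
    (u' := fun x => A * W.weight l x) (v := fun x => V.weight m x * V.weight m x)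
    (v' := fun x => B * V.weight l x) hA hB hω hω' (A := A * supNorm (W.weight l) f)
    (B := B * supNorm (V.weight l) g) (norm_mul_le_of_le (fun _ => le_rfl) hfw)
    (by rw [hfg]; exact norm_mul_le_of_le (fun _ => le_rfl) hgv)
  refine ⟨m, A * supNorm (W.weight l) f * (∫ t, ‖θ t‖ * (W.weight n t : ℝ)) +
    B * supNorm (V.weight l) g * ∫ t, ‖𝓕 θ t‖ * (V.weight n' t : ℝ), fun x ξ => ?_⟩
  have h4 : (0 : ℝ) < W.weight m x := by exact_mod_cast W.weight_pos m x
  have h5 : (0 : ℝ) < V.weight m ξ := by exact_mod_cast V.weight_pos m ξ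
  rw [← mul_inv, ← div_eq_mul_inv, le_div_iff₀ (by positivity)]
  refine le_of_eq_of_le ?_ (h3 x ξ)
  push_cast
  ring

end Reproducing

/-! ### Domination of seminorms by the projective description. -/

section MainEstimate

variable {d : ℕ} {V W : WeightFunctionSystem d}

theorem eq_zero_of_density_eq_zero {v w : Rd d → ℝ≥0} {T : 𝓢'(Rd d, ℂ)} (hT : T ∈ bbSubmodule v w)
    (h : density T = 0) : T = 0 := by
  have h1 := represents_density_of_mem hT
  rw [h] at h1
  have h0 : Integrable ((0 : C(Rd d, ℂ)) : Rd d → ℂ) := integrable_zero _ _ _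
  rw [h1.eq_ofIntegrable h0, (Represents.zero (d := d)).eq_ofIntegrable h0]

/-- The estimate of a seminorm on a single step in terms of a bound for the short-time Fourier
transform. -/
theorem seminorm_le_of_norm_stft_le (hVM : V.RoumieuM) (hVSq : V.RoumieuSq) (hVN : V.RoumieuN)
    (hWM : W.RoumieuM) (hWSq : W.RoumieuSq) (hWN : W.RoumieuN)
    (p : Seminorm ℂ (Roumieu V W))
    (hp : ∀ l, ∃ C : ℝ, 0 < C ∧ ∀ y, p (Roumieu.ofStep V W l y) ≤ C * ‖y‖)
    {n : Set.Ioi (0 : ℝ)} {γ γ' : C(Rd d, ℂ)} (hγ : FourierIntegrable γ)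
    (hγ' : 𝓕 (γ : Rd d → ℂ) = γ') (hγw : γ ∈ weightedSpace (W.weight n))
    (hγv : γ' ∈ weightedSpace (V.weight n)) {e : Rd d → Rd d → Roumieu V W}
    (he : ∀ x ξ, Roumieu.toDistribution V W (e x ξ) = atomDistribution hγ x ξ)
    {θ : Rd d → ℂ} (hθ : FourierIntegrable θ) (hc : windowPairing θ γ ≠ 0)
    {k k' : Set.Ioi (0 : ℝ)} (hω : Integrable fun x => ‖θ x‖ * (W.weight k x : ℝ))
    (hω' : Integrable fun x => ‖𝓕 θ x‖ * (V.weight k' x : ℝ)) (φ : Roumieu V W)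
    {b : Rd d × Rd d → ℝ} (hb : Integrable b volume)
    (hpb : ∀ x ξ, ‖stft (density (Roumieu.toDistribution V W φ)) θ x ξ‖ * p (e x ξ) ≤ b (x, ξ)) :
    p φ ≤ ‖(windowPairing θ γ)⁻¹‖ * ∫ q, b q := by
  set T := Roumieu.toDistribution V W φ
  obtain ⟨l₁, hT⟩ : ∃ l, T ∈ bbSubmodule (V.weight l) (W.weight l) := φ.2
  have hf := fourierIntegrable_density hVN hWN hT
  have hf' := fourier_density hWN hT
  obtain ⟨m, D, hD⟩ := exists_norm_stft_le_inv_weight hVM hVSq hWM hWSq hθ hω hω' hf hf'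
    (density_mem_weightedSpace hT) (density_fourier_mem_weightedSpace hT)
  -- The decay of Vφ fixes m first; only then is a step chosen in which the shifts of γ grow no
  -- faster than w^m(x) v^m(ξ).
  obtain ⟨l₂, h₂⟩ := exists_atomDistribution_mem hVM hWM hγ hγ' hγw hγv m
  obtain ⟨l₃, h₃⟩ := exists_continuous_toBounded_atom hVM hVSq hVN hWM hWSq hWN hγ hγ' hγw hγv
  set l := max l₁ (max l₂ l₃)
  obtain ⟨K, hK0, hK⟩ := h₂ l ((le_max_left _ _).trans (le_max_right _ _))
  choose hmem hKn using hK
  have hcont := h₃ l ((le_max_right _ _).trans (le_max_right _ _)) hmem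
  have hTl : T ∈ bbSubmodule (V.weight l) (W.weight l) :=
    bbSubmodule_le (V.weight_le_weight _ _ (le_max_left _ _))
      (W.weight_le_weight _ _ (le_max_left _ _)) hT
  obtain ⟨C, hC0, hC⟩ := hp l
  have hSc := continuous_stft hf hθ
  have hDi : Integrable (fun q : Rd d × Rd d =>
      D * ((W.weight m q.1 : ℝ)⁻¹ * (V.weight m q.2 : ℝ)⁻¹)) volume :=
    ((hWN.integrable_inv_weight m).mul_prod (hVN.integrable_inv_weight m)).const_mul D
  have hW1 : ∀ x, (1 : ℝ) ≤ W.weight m x := fun x => by exact_mod_cast W.one_le_weight m x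
  have hV1 : ∀ x, (1 : ℝ) ≤ V.weight m x := fun x => by exact_mod_cast V.one_le_weight m x
  have hS : Integrable (fun q : Rd d × Rd d => stft (density T) θ q.1 q.2) volume := by
    refine hDi.mono' hSc.aestronglyMeasurable (Filter.Eventually.of_forall fun q => ?_)
    exact (le_mul_of_one_le_right (norm_nonneg _)
      (one_le_mul_of_one_le_of_one_le (hW1 q.1) (hV1 q.2))).trans (hD q.1 q.2)
  set J := BBSpace.toBounded (V.continuous_weight l) (W.continuous_weight l) with hJ
  set c := (windowPairing θ γ)⁻¹
  let F : Rd d × Rd d → BBSpace (V.weight l) (W.weight l) := fun q =>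
    (c * stft (density T) θ q.1 q.2) • BBSpace.mk _ (hmem q.1 q.2)
  have hJF : ∀ q, J (F q) = (c * stft (density T) θ q.1 q.2) • J (BBSpace.mk _ (hmem q.1 q.2)) :=
    fun q => map_smul J _ _
  have hF : Integrable (fun q => J (F q)) volume := by
    refine (hDi.const_mul (‖c‖ * K)).mono' ?_ (Filter.Eventually.of_forall fun q => ?_)
    · simp only [hJF]
      -- Spaces of bounded continuous functions need not be separable; strong measurability comes
      -- from the second countable domain.
      have : SecondCountableTopologyEither (Rd d × Rd d)
          (BoundedContinuousFunction (Rd d) ℂ × BoundedContinuousFunction (Rd d) ℂ) :=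
        secondCountableTopologyEither_of_left _ _
      exact ((continuous_const.mul hSc).smul hcont).aestronglyMeasurable
    · rw [hJF, norm_smul, norm_mul]
      calc ‖c‖ * ‖stft (density T) θ q.1 q.2‖ * ‖J (BBSpace.mk _ (hmem q.1 q.2))‖ ≤
            ‖c‖ * ‖stft (density T) θ q.1 q.2‖ * (K * W.weight m q.1 * V.weight m q.2) := by
            have := (BBSpace.norm_toBounded_le (V.continuous_weight l) (W.continuous_weight l)
              (BBSpace.mk _ (hmem q.1 q.2))).trans (hKn q.1 q.2)
            gcongr
        _ = ‖c‖ * K * (‖stft (density T) θ q.1 q.2‖ * (W.weight m q.1 * V.weight m q.2)) := by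
            ring
        _ ≤ _ := by
            have := hD q.1 q.2
            gcongr
  have hrep := toBounded_eq_integral (V.continuous_weight l) (W.continuous_weight l) hγ hθ hc hTl
    hf hf' hmem hS hF
  have hemk : ∀ x ξ, Roumieu.ofStep V W l (BBSpace.mk _ (hmem x ξ)) = e x ξ := fun x ξ =>
    Subtype.ext (he x ξ).symm
  have hmkφ : Roumieu.ofStep V W l (BBSpace.mk T hTl) = φ := Subtype.ext rfl
  have hmain := seminorm_le_integral J (p.comp (Roumieu.ofStep V W l)) (C := C * 2)
    (fun y => (hC y).trans (by
      have := BBSpace.norm_le_toBounded (V.continuous_weight l) (W.continuous_weight l) y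
      rw [mul_assoc]
      gcongr)) hF hrep (hb.const_mul ‖c‖) fun q => by
        rw [Seminorm.comp_apply, map_smul, map_smul_eq_mul, hemk, norm_mul, mul_assoc]
        exact mul_le_mul_of_nonneg_left (hpb q.1 q.2) (norm_nonneg _)
  rw [Seminorm.comp_apply, hmkφ, integral_const_mul] at hmain
  exact hmain

/-- A seminorm on the Roumieu space that is continuous on all the steps is dominated by one of the
seminorms of the projective description. -/
theorem exists_nachbin_seminorm_le (hVM : V.RoumieuM) (hVSq : V.RoumieuSq) (hVN : V.RoumieuN)
    (hWM : W.RoumieuM) (hWSq : W.RoumieuSq) (hWN : W.RoumieuN)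
    (p : Seminorm ℂ (Roumieu V W))
    (hp : ∀ l, ∃ C : ℝ, 0 < C ∧ ∀ y, p (Roumieu.ofStep V W l y) ≤ C * ‖y‖) :
    ∃ v ∈ V.nachbin, ∃ w ∈ W.nachbin, ∃ C : ℝ, 0 ≤ C ∧ ∀ φ : Roumieu V W,
      p φ ≤ C * (supNorm w (density (Roumieu.toDistribution V W φ)) +
        supNorm v (density (𝓕 (Roumieu.toDistribution V W φ)))) := by
  -- The hypotheses do not supply a nonzero element; without one there is no window, but then p
  -- vanishes identically.
  by_cases htriv : ∀ φ : Roumieu V W, density (Roumieu.toDistribution V W φ) = 0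
  · refine ⟨0, V.zero_mem_nachbin, 0, W.zero_mem_nachbin, 0, le_rfl, fun φ => ?_⟩
    obtain ⟨l, hl⟩ : ∃ l, Roumieu.toDistribution V W φ ∈ bbSubmodule (V.weight l) (W.weight l) :=
      φ.2
    have hφ : φ = 0 := Subtype.ext (eq_zero_of_density_eq_zero hl (htriv φ))
    rw [hφ, map_zero, zero_mul]
  push Not at htriv
  obtain ⟨ψ, hψ⟩ := htriv
  obtain ⟨n, hn⟩ : ∃ l, Roumieu.toDistribution V W ψ ∈ bbSubmodule (V.weight l) (W.weight l) :=
    ψ.2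
  obtain ⟨y₀, hy₀⟩ := DFunLike.ne_iff.1 hψ
  set γ := density (Roumieu.toDistribution V W ψ)
  set γ' := density (𝓕 (Roumieu.toDistribution V W ψ))
  have hγ : FourierIntegrable γ := fourierIntegrable_density hVN hWN hn
  have hγ' : 𝓕 (γ : Rd d → ℂ) = γ' := fourier_density hWN hn
  have hγw : γ ∈ weightedSpace (W.weight n) := density_mem_weightedSpace hn
  have hγv : γ' ∈ weightedSpace (V.weight n) := density_fourier_mem_weightedSpace hn
  obtain ⟨a, ζ, hc⟩ := exists_windowPairing_ne_zero hγ hy₀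
  have hmem := exists_atomDistribution_mem hVM hWM hγ hγ' hγw hγv
  have hθ := hγ.atom_right a ζ
  set θ := atom γ a ζ
  obtain ⟨l₀, hl₀⟩ := hmem n
  obtain ⟨_, _, hl₀⟩ := hl₀ l₀ le_rfl
  have hm₀ := fun x ξ => (hl₀ x ξ).1
  obtain ⟨k, hω⟩ := exists_integrable_norm_mul_weight hWN (density_mem_weightedSpace (hm₀ a ζ))
  obtain ⟨k', hω'⟩ := exists_integrable_norm_mul_weight hVN
    (density_fourier_mem_weightedSpace (hm₀ a ζ))
  rw [density_atomDistribution] at hω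
  rw [density_fourier_atomDistribution] at hω'
  let e : Rd d → Rd d → Roumieu V W := fun x ξ => Roumieu.ofStep V W l₀ (BBSpace.mk _ (hm₀ x ξ))
  have hu : ∀ m, ∃ C : ℝ≥0, ∀ x ξ,
      (p (e x ξ)).toNNReal ≤ C * W.weight m x * V.weight m ξ := fun m => by
    obtain ⟨l, hl⟩ := hmem m
    obtain ⟨K, hK0, hK⟩ := hl l le_rfl
    obtain ⟨C, hC0, hC⟩ := hp l
    refine ⟨C.toNNReal * K.toNNReal, fun x ξ => Real.toNNReal_le_iff_le_coe.2 ?_⟩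
    obtain ⟨hmx, hKx⟩ := hK x ξ
    have h1 : e x ξ = Roumieu.ofStep V W l (BBSpace.mk _ hmx) := Subtype.ext rfl
    rw [h1]
    refine (hC _).trans ((mul_le_mul_of_nonneg_left hKx hC0.le).trans (le_of_eq ?_))
    push_cast
    rw [Real.coe_toNNReal _ hC0.le, Real.coe_toNNReal _ hK0]
    ring
  obtain ⟨w₀, hw₀, v₀, hv₀, hwv⟩ := WeightFunctionSystem.exists_nachbin_tensor hu
  obtain ⟨h, hh0, hhi, hhd⟩ := hWN.exists_integrable_dominated_inv
  obtain ⟨g, hg0, hgi, hgd⟩ := hVN.exists_integrable_dominated_inv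
  -- A bound on |Vφ| (w₀/h)(v₀/g) bounds |Vφ| w₀ v₀ by a multiple of the integrable hg. The squares
  -- of these quotients are then moderated by the weights k and k' against which θ and θ̂ are
  -- integrable.
  have hud := (WeightFunctionSystem.dominated_of_mem_nachbin hw₀).mul hWSq hhd
  have hvd := (WeightFunctionSystem.dominated_of_mem_nachbin hv₀).mul hVSq hgd
  obtain ⟨w, hw, hwm⟩ := (hud.mul hWSq hud).exists_moderate hWM k
  obtain ⟨v, hv, hvm⟩ := (hvd.mul hVSq hvd).exists_moderate hVM k'
  set I₁ := ∫ t, ‖θ t‖ * (W.weight k t : ℝ)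
  set I₂ := ∫ t, ‖𝓕 θ t‖ * (V.weight k' t : ℝ)
  have hI₁ : 0 ≤ I₁ := integral_nonneg fun t => by positivity
  have hI₂ : 0 ≤ I₂ := integral_nonneg fun t => by positivity
  set H := ∫ q : Rd d × Rd d, (h q.1 : ℝ) * (g q.2 : ℝ)
  have hH : 0 ≤ H := integral_nonneg fun q => by positivity
  refine ⟨v, hv, w, hw, ‖(windowPairing θ γ)⁻¹‖ * ((I₁ + I₂) * H), by positivity, fun φ => ?_⟩
  set T := Roumieu.toDistribution V W φ
  obtain ⟨l, hT⟩ : ∃ l, T ∈ bbSubmodule (V.weight l) (W.weight l) := φ.2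
  have hf := fourierIntegrable_density hVN hWN hT
  have hf' := fourier_density hWN hT
  have hfw : density T ∈ weightedSpace w := by
    obtain ⟨C, hC⟩ := WeightFunctionSystem.dominated_of_mem_nachbin hw l
    exact mem_weightedSpace_of_le (norm_mul_le_of_le hC (density_mem_weightedSpace hT))
  have hfv : density (𝓕 T) ∈ weightedSpace v := by
    obtain ⟨C, hC⟩ := WeightFunctionSystem.dominated_of_mem_nachbin hv l
    exact mem_weightedSpace_of_le (norm_mul_le_of_le hC (density_fourier_mem_weightedSpace hT))
  set A := supNorm w (density T)
  set B := supNorm v (density (𝓕 T))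
  have hA0 : 0 ≤ A := supNorm_nonneg _ _
  have hB0 : 0 ≤ B := supNorm_nonneg _ _
  have hstft := norm_stft_mul_mul_le hf hθ (u := fun x => w₀ x * (h x)⁻¹)
    (v := fun x => v₀ x * (g x)⁻¹) hwm hvm hω hω' (norm_mul_le_supNorm hfw)
    (by rw [hf']; exact norm_mul_le_supNorm hfv)
  have hb : Integrable (fun q : Rd d × Rd d => (A * I₁ + B * I₂) * ((h q.1 : ℝ) * (g q.2 : ℝ)))
      volume := (hhi.mul_prod hgi).const_mul _
  refine (seminorm_le_of_norm_stft_le hVM hVSq hVN hWM hWSq hWN p hp hγ hγ' hγw hγv (e := e)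
    (fun x ξ => rfl) hθ hc hω hω' φ hb fun x ξ => ?_).trans ?_
  · have h1 : p (e x ξ) ≤ w₀ x * v₀ ξ := by
      have := Real.toNNReal_le_iff_le_coe.1 (hwv x ξ)
      exact_mod_cast this
    have h2 := hstft x ξ
    have h3 : (0 : ℝ) < h x := by exact_mod_cast pos_iff_ne_zero.2 (hh0 x)
    have h4 : (0 : ℝ) < g ξ := by exact_mod_cast pos_iff_ne_zero.2 (hg0 ξ)
    calc ‖stft (density T) θ x ξ‖ * p (e x ξ) ≤ ‖stft (density T) θ x ξ‖ * (w₀ x * v₀ ξ) := by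
          gcongr
      _ = ‖stft (density T) θ x ξ‖ * (((w₀ x * (h x)⁻¹ : ℝ≥0) : ℝ) * ((v₀ ξ * (g ξ)⁻¹ : ℝ≥0) : ℝ)) *
            (h x * g ξ) := by
          push_cast
          field_simp
      _ ≤ _ := by gcongr
  · rw [integral_const_mul, mul_assoc]
    refine mul_le_mul_of_nonneg_left ?_ (norm_nonneg _)
    change (A * I₁ + B * I₂) * H ≤ (I₁ + I₂) * H * (A + B)
    rw [mul_right_comm]
    refine mul_le_mul_of_nonneg_right ?_ hH
    nlinarith [mul_nonneg hA0 hI₂, mul_nonneg hB0 hI₁]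

end MainEstimate

/-! ### Equality of sets and of topologies. -/

section Topology

open scoped ComplexOrder

variable {d : ℕ} {V W : WeightFunctionSystem d}

theorem exists_mem_weightedSpace_weight {f : C(Rd d, ℂ)}
    (h : ∀ w ∈ W.nachbin, f ∈ weightedSpace w) : ∃ l, f ∈ weightedSpace (W.weight l) := by
  obtain ⟨l, B, hB⟩ := WeightFunctionSystem.exists_bddAbove_mul_weight (W := W)
    (f := fun x => ‖f x‖₊) fun w hw => by
      refine ⟨(supNorm w f).toNNReal, ?_⟩
      rintro _ ⟨x, rfl⟩
      refine NNReal.le_toNNReal_of_coe_le ?_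
      push_cast
      exact norm_mul_le_supNorm (h w hw) x
  refine ⟨l, mem_weightedSpace_of_le (K := B) fun x => ?_⟩
  have h1 : ‖f x‖₊ * W.weight l x ≤ B := hB ⟨x, rfl⟩
  exact_mod_cast h1

/-- The Roumieu space and its projective description coincide as sets. -/
theorem roumieuSubmodule_eq_projSubmodule (V W : WeightFunctionSystem d) :
    roumieuSubmodule V W = projSubmodule V W := by
  refine le_antisymm ?_ fun T hT => ?_
  · rintro T ⟨l, hT⟩ v hv w hw
    obtain ⟨A, hA⟩ := WeightFunctionSystem.dominated_of_mem_nachbin hv l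
    obtain ⟨B, hB⟩ := WeightFunctionSystem.dominated_of_mem_nachbin hw l
    exact mem_bbSubmodule_of_represents (represents_density_of_mem hT)
      (represents_density_fourier_of_mem hT)
      (mem_weightedSpace_of_le (norm_mul_le_of_le hB (density_mem_weightedSpace hT)))
      (mem_weightedSpace_of_le (norm_mul_le_of_le hA (density_fourier_mem_weightedSpace hT)))
  · have h0 := hT 0 V.zero_mem_nachbin 0 W.zero_mem_nachbin
    obtain ⟨l, hl⟩ := exists_mem_weightedSpace_weight (W := W) fun w hw =>
      density_mem_weightedSpace (hT 0 V.zero_mem_nachbin w hw)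
    obtain ⟨m, hm⟩ := exists_mem_weightedSpace_weight (W := V) fun v hv =>
      density_fourier_mem_weightedSpace (hT v hv 0 W.zero_mem_nachbin)
    refine ⟨max l m, mem_bbSubmodule_of_represents (represents_density_of_mem h0)
      (represents_density_fourier_of_mem h0)
      (mem_weightedSpace_of_le (K := supNorm (W.weight l) (density T)) fun x => ?_)
      (mem_weightedSpace_of_le (K := supNorm (V.weight m) (density (𝓕 T))) fun x => ?_)⟩
    · refine (mul_le_mul_of_nonneg_left ?_ (norm_nonneg _)).trans (norm_mul_le_supNorm hl x)
      exact_mod_cast W.weight_le_weight _ _ (le_max_left l m) x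
    · refine (mul_le_mul_of_nonneg_left ?_ (norm_nonneg _)).trans (norm_mul_le_supNorm hm x)
      exact_mod_cast V.weight_le_weight _ _ (le_max_right l m) x

/-- The identity map from the Roumieu space to its projective description. -/
noncomputable def roumieuEquivProjDescr (V W : WeightFunctionSystem d) :
    Roumieu V W ≃ₗ[ℂ] ProjDescr V W :=
  LinearEquiv.ofEq _ _ (roumieuSubmodule_eq_projSubmodule V W)

theorem toDistribution_roumieuEquivProjDescr (φ : Roumieu V W) :
    ProjDescr.toDistribution V W (roumieuEquivProjDescr V W φ) = Roumieu.toDistribution V W φ :=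
  rfl

theorem ProjDescr.withSeminorms (V W : WeightFunctionSystem d) :
    WithSeminorms (ProjDescr.seminormFamily V W) :=
  ⟨rfl⟩

theorem continuous_ofStep_projDescr (V W : WeightFunctionSystem d) (l : Set.Ioi (0 : ℝ)) :
    Continuous fun y => roumieuEquivProjDescr V W (Roumieu.ofStep V W l y) := by
  refine WithSeminorms.continuous_normedSpace_dom (BBSpace (V.weight l) (W.weight l))
    (ProjDescr.withSeminorms V W)
    ((roumieuEquivProjDescr V W).toLinearMap ∘ₗ Roumieu.ofStep V W l) fun vw => ?_
  obtain ⟨A, hA⟩ := WeightFunctionSystem.dominated_of_mem_nachbin vw.1.2 l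
  obtain ⟨B, hB⟩ := WeightFunctionSystem.dominated_of_mem_nachbin vw.2.2 l
  refine ⟨A + B, fun y => ?_⟩
  set T := BBSpace.toDistribution _ _ y with hT
  have h1 : supNorm vw.2.1 (density T) ≤ B * supNorm (W.weight l) (density T) :=
    supNorm_le (norm_mul_le_of_le hB (density_mem_weightedSpace y.toDistribution_mem))
  have h2 : supNorm vw.1.1 (density (𝓕 T)) ≤ A * supNorm (V.weight l) (density (𝓕 T)) :=
    supNorm_le (norm_mul_le_of_le hA (density_fourier_mem_weightedSpace y.toDistribution_mem))
  have h3 := supNorm_nonneg (W.weight l) (density T)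
  have h4 := supNorm_nonneg (V.weight l) (density (𝓕 T))
  change supNorm vw.2.1 (density T) + supNorm vw.1.1 (density (𝓕 T)) ≤ ((A + B : ℝ≥0) : ℝ) * ‖y‖
  rw [BBSpace.norm_eq, ← hT]
  push_cast
  nlinarith [mul_nonneg A.coe_nonneg h3, mul_nonneg B.coe_nonneg h4]

/-- A topology induced by a linear map from a locally convex space is locally convex. -/
theorem induced_locallyConvexSpace {E F ι : Type*} [AddCommGroup E] [Module ℂ E] [AddCommGroup F]
    [Module ℂ F] [TopologicalSpace F] {q : SeminormFamily ℂ F ι} (hq : WithSeminorms q)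
    (f : E →ₗ[ℂ] F) :
    @IsTopologicalAddGroup E (TopologicalSpace.induced f inferInstance) _ ∧
      @ContinuousSMul ℂ E _ _ (TopologicalSpace.induced f inferInstance) ∧
      @LocallyConvexSpace ℝ E _ _ _ _ (TopologicalSpace.induced f inferInstance) := by
  let _ : TopologicalSpace E := TopologicalSpace.induced f inferInstance
  have h := LinearMap.withSeminorms_induced hq f
  exact ⟨h.topologicalAddGroup, h.continuousSMul, h.toLocallyConvexSpace⟩

/-- The topology pulled back from the projective description is one of the competitors in the
infimum that defines the inductive limit topology. -/
theorem continuous_roumieuEquivProjDescr (V W : WeightFunctionSystem d) :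
    Continuous (roumieuEquivProjDescr V W) := by
  obtain ⟨h1, h2, h3⟩ := induced_locallyConvexSpace (ProjDescr.withSeminorms V W)
    (roumieuEquivProjDescr V W).toLinearMap
  rw [continuous_iff_le_induced]
  exact sInf_le ⟨h1, h2, h3, fun l =>
    continuous_induced_rng.2 (continuous_ofStep_projDescr V W l)⟩

/-- The topology of a complex locally convex space is generated by a family of seminorms. -/
theorem exists_withSeminorms_of_locallyConvexSpace.{u} (E : Type u) [AddCommGroup E] [Module ℂ E]
    [TopologicalSpace E] [IsTopologicalAddGroup E] [ContinuousSMul ℂ E]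
    [LocallyConvexSpace ℝ E] : ∃ (ι : Type u) (p : SeminormFamily ℂ E ι), WithSeminorms p := by
  have : ContinuousSMul ℝ E := IsScalarTower.continuousSMul ℂ
  -- Gauge seminorms over ℂ use convexity for the complex order, whose nonnegative scalars are
  -- exactly the nonnegative reals.
  have : LocallyConvexSpace ℂ E := by
    refine (locallyConvexSpace_iff_exists_convex_subset_zero ℂ E).2 fun U hU => ?_
    obtain ⟨S, hS, hc, hSU⟩ := (locallyConvexSpace_iff_exists_convex_subset_zero ℝ E).1
      inferInstance U hU
    exact ⟨S, hS, convex_of_nonneg_surjective_algebraMap _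
      (fun _ => (RCLike.nonneg_iff_exists_ofReal (K := ℂ)).mp) hc, hSU⟩
  exact ⟨_, _, with_gaugeSeminormFamily⟩

/-- Continuity into an infimum of topologies is tested on each competitor separately. Each is
generated by seminorms that are continuous on all steps, so `exists_nachbin_seminorm_le` applies to
them one at a time. -/
theorem continuous_roumieuEquivProjDescr_symm (hVM : V.RoumieuM) (hVSq : V.RoumieuSq)
    (hVN : V.RoumieuN) (hWM : W.RoumieuM) (hWSq : W.RoumieuSq) (hWN : W.RoumieuN) :
    Continuous (roumieuEquivProjDescr V W).symm := by
  refine continuous_sInf_rng.2 ?_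
  rintro t ⟨h1, h2, h3, h4⟩
  obtain ⟨ι, q, hq⟩ := @exists_withSeminorms_of_locallyConvexSpace (Roumieu V W) _ _ t h1 h2 h3
  refine WithSeminorms.continuous_of_isBounded (ProjDescr.withSeminorms V W) hq
    (roumieuEquivProjDescr V W).symm.toLinearMap fun i => ?_
  have hqi : @Continuous _ _ t _ (q i) := hq.continuous_seminorm i
  obtain ⟨v, hv, w, hw, C, hC0, hC⟩ := exists_nachbin_seminorm_le hVM hVSq hVN hWM hWSq hWN (q i)
    fun l => Seminorm.bound_of_continuous_normedSpace ((q i).comp (Roumieu.ofStep V W l))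
      (hqi.comp (h4 l))
  refine ⟨{(⟨v, hv⟩, ⟨w, hw⟩)}, C.toNNReal, fun φ => ?_⟩
  have h5 := hC ((roumieuEquivProjDescr V W).symm φ)
  rw [Finset.sup_singleton]
  change _ ≤ (C.toNNReal : ℝ) * _
  rw [Real.coe_toNNReal _ hC0]
  exact h5

end Topology

end BeurlingBjorck

theorem theorem4p7 (d : ℕ) (V W : BeurlingBjorck.WeightFunctionSystem d)
    (hVM : V.RoumieuM) (hVSq : V.RoumieuSq) (hVN : V.RoumieuN)
    (hWM : W.RoumieuM) (hWSq : W.RoumieuSq) (hWN : W.RoumieuN) :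
    ∃ e : BeurlingBjorck.Roumieu V W ≃L[ℂ] BeurlingBjorck.ProjDescr V W,
      ∀ φ : BeurlingBjorck.Roumieu V W,
        BeurlingBjorck.ProjDescr.toDistribution V W (e φ) =
          BeurlingBjorck.Roumieu.toDistribution V W φ :=
  ⟨{ toLinearEquiv := BeurlingBjorck.roumieuEquivProjDescr V W
     continuous_toFun := BeurlingBjorck.continuous_roumieuEquivProjDescr V W
     continuous_invFun :=
      BeurlingBjorck.continuous_roumieuEquivProjDescr_symm hVM hVSq hVN hWM hWSq hWN },
    fun φ => BeurlingBjorck.toDistribution_roumieuEquivProjDescr φ⟩
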